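/- **Setting.** Let $(E,\mathcal E,\mu)$ be a $\sigma$-finite measure space, $\mathscr P=L_\infty(E,\mu)\cap L_1(E,\mu)$, and let $\|\cdot\|_\infty$ be the essential supremum norm. Let $X_1,\dots,X_n$ ($n\ge 2$) be independent random variables with values in $E$, with laws $P_i^\star=p_i^\star\,d\mu$, $p_i^\star\in L_\infty(E,\mu)$. Put $P^\star=\frac1n\sum_iP_i^\star$ and $p^\star=\frac1n\sum_i p_i^\star$. Let $\mathcal C$ be a class of measurable sets of finite VC-dimension $V$. For $h>0$ and $f\in\mathscr P$ let $$|f|_h=\sup_{C\in\mathcal C}\frac{|\int_C f\,d\mu|}{\mu(C)+h},\qquad \kappa_m(h)=\inf_{p,q\in m}\frac{|p-q|_h}{\|p-q\|_\infty}\quad(m\subset\mathscr P),\qquad |\hat p|_h=\sup_{C\in\mathcal C}\frac{\sum_{i=1}^n 1_C(X_i)}{n(\mu(C)+h)},$$ and, for a map $C_h:\mathscr P^2\to\mathcal C$, $$1-\varepsilon_m(h,C_h)=\inf_{p,q\in m}\frac{|\int_{C_h(p,q)}(p-q)\,d\mu|}{(\mu(C_h(p,q))+h)\,|p-q|_h}$$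 (with $0/0=1$ in both infima). Let $\log_-$ be the negative part of $\log$ and, for $a>0$, $$\Gamma=\log\lceil\log_2 n\rceil+\log\Big(2\sum_{j=0}^{V\wedge n}\binom nj\Big),\qquad \mathrm{pen}_a(h)=29\sqrt{\tfrac43}\sqrt{\frac{|\hat p|_h(\Gamma+a\log_-(h))}{hn}}+\sqrt{\tfrac43}\,29^2\,\frac{\Gamma+a\log_-(h)}{hn}.$$ Let $\mathcal M$ be an at most countable collection of at most countable models $m\subset\mathscr P$, $\mathbf M=\bigcup_{m\in\mathcal M}m$, with bandwidths $h_m>0$, and let $C_h:\mathscr P^2\to\mathcal C$ $(h>0)$ be given. For $p\in\mathbf M$ let $h_p=\sup\{h_m: m\in\mathcal M,\,p\in m\}\in(0,\infty]$. Let $\tau_h(p,q)\in\{-1,1\}$ be the sign of $\int_{C_h(p,q)}(p-q)\,d\mu$ ($1$ if it vanishes) and $$T^{(h)}(\mathbf X,p,q)=\frac1n\sum_{i=1}^n\tau_h(p,q)\frac{\int_{C_h(p,q)}p\,d\mu-1_{C_h(p,q)}(X_i)}{\mu(C_h(p,q))+h},$$ $$T_{\mathcal M}(\mathbf X,p)=\sup_{q\in\mathbf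 M}\big\{T^{(h_p\wedge h_q)}(\mathbf X,p,q)-\mathrm{pen}_a(h_q)\big\}+\mathrm{pen}_a(h_p),$$ with $T^{(\infty)}=0$ and $\mathrm{pen}_a(\infty)=0$. For $\delta>0$, a moshun-estimator with tolerance $\delta$ is any random element $\hat p_{\mathcal M}\in\mathbf M$ such that $T_{\mathcal M}(\mathbf X,\hat p_{\mathcal M})\le\inf_{p\in\mathbf M}T_{\mathcal M}(\mathbf X,p)+\delta$. **Theorem.** Let $a>0$ and $y\ge e$. Assume $$\kappa_*=\inf_{m,m'\in\mathcal M}\kappa_{m\cup m'}(h_m\wedge h_{m'})>0 .$$ Then there is an event $A$ with $\mathbb P(A)\ge 1-2y^{-a}$ on which, for every $\varepsilon<1$ with $\sup_{h>0}\varepsilon_{\mathbf M}(h,C_h)\le\varepsilon$, every $\delta>0$ and every moshun-estimator $\hat p_{\mathcal M}$ with tolerance $\delta$, $$(1-\varepsilon)\kappa_*\|\hat p_{\mathcal M}-p^\star\|_\infty\le\inf_{m\in\mathcal M}\Big\{(2+(1-\varepsilon)\kappa_*)\inf_{p\in m}\|p-p^\star\|_\infty+4\,\mathrm{pen}_a(h_m)\Big\}+29y\sqrt{\frac{2a}{3en}}+29^2\frac{4}{\sqrt3}\frac{ay}{en}+\delta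 .$$ Moreover, suppose that $\mathcal C$ is pointwise measurable, i.e. there is a countable $\mathcal C_0\subset\mathcal C$ such that the indicator of each $C\in\mathcal C$ is the pointwise limit of a sequence of indicators of members of $\mathcal C_0$. Then $A$ can be chosen independently of $\mathcal M$, $(h_m)$ and $(C_h)$, and contained in the event $\Omega_{a\log y}$, where $\Omega_x$ is the event that $$\frac1n\Big|\sum_{i=1}^n 1_C(X_i)-P_i^\star(C)\Big|\le\max\Big(29\sqrt{P^\star(C)}\sqrt{\tfrac{\Gamma+x}{n}},\,20\,\tfrac{\Gamma+x}{n}\Big)\quad\text{for all }C\in\mathcal C.$$ -/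

import Mathlib

open MeasureTheory ProbabilityTheory
open scoped ENNReal NNReal

noncomputable section

namespace SupNormDensity

variable {E : Type*} [MeasurableSpace E]

/-! ### Classes of sets -/

/-- The finite set `s` is shattered by the class `𝒞`. -/
def Shatters {α : Type*} (𝒞 : Set (Set α)) (s : Finset α) : Prop :=
  ∀ t : Finset α, t ⊆ s → ∃ C ∈ 𝒞, (s : Set α) ∩ C = (t : Set α)

/-- Vapnik-Chervonenkis dimension: the largest cardinality of a shattered finite set. -/
def vcDim {α : Type*} (𝒞 : Set (Set α)) : ℕ∞ :=
  ⨆ (s : Finset α) (_ : Shatters 𝒞 s), (s.card : ℕ∞)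

/-- Pointwise measurable class: some countable subclass is such that the indicator of every member
of the class is the pointwise limit of a sequence of indicators of members of the subclass. -/
def PointwiseMeasurableClass {α : Type*} (𝒞 : Set (Set α)) : Prop :=
  ∃ 𝒞₀ : Set (Set α), 𝒞₀ ⊆ 𝒞 ∧ 𝒞₀.Countable ∧
    ∀ C ∈ 𝒞, ∃ D : ℕ → Set α, (∀ k, D k ∈ 𝒞₀) ∧
      ∀ x, ∀ᶠ k in Filter.atTop, (x ∈ D k ↔ x ∈ C)

/-! ### The space `L∞ ∩ L¹`, norms -/

/-- `L∞(E, μ) ∩ L¹(E, μ)`, a space of classes of functions modulo `μ`-a.e. equality. -/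
def LinfL1 (μ : Measure E) : Submodule ℝ (E →ₘ[μ] ℝ) :=
  Lp.LpSubmodule ℝ ℝ ∞ μ ⊓ Lp.LpSubmodule ℝ ℝ 1 μ

variable {μ : Measure E}

/-- The `μ`-essential supremum of `|f|`. -/
def supNorm (f : LinfL1 μ) : ℝ≥0∞ := eLpNorm (f : E →ₘ[μ] ℝ) ∞ μ

/-- The signed measure with density `f`, evaluated at `C`: `∫_C f dμ`. -/
def mass (f : LinfL1 μ) (C : Set E) : ℝ := ∫ x in C, (f : E →ₘ[μ] ℝ) x ∂μ

/-- `|f|_h = sup_{C ∈ 𝒞} |∫_C f dμ| / (μ(C) + h)`. -/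
def hNorm (𝒞 : Set (Set E)) (h : ℝ) (f : LinfL1 μ) : ℝ≥0∞ :=
  ⨆ C ∈ 𝒞, ENNReal.ofReal |mass f C| / (μ C + ENNReal.ofReal h)

open Classical in
/-- `κ_m(h) = inf_{p, q ∈ m} |p - q|_h / ‖p - q‖_∞`, with `0 / 0` read as `1`. -/
def kappa (𝒞 : Set (Set E)) (m : Set (LinfL1 μ)) (h : ℝ) : ℝ≥0∞ :=
  ⨅ p ∈ m, ⨅ q ∈ m, if p = q then 1 else hNorm 𝒞 h (p - q) / supNorm (p - q)

/-- `κ_* = inf_{m, m' ∈ ℳ} κ_{m ∪ m'}(h_m ∧ h_{m'})`. -/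
def kappaStar (𝒞 : Set (Set E)) (ℳ : Set (Set (LinfL1 μ))) (hM : Set (LinfL1 μ) → ℝ) : ℝ≥0∞ :=
  ⨅ m ∈ ℳ, ⨅ m' ∈ ℳ, kappa 𝒞 (m ∪ m') (min (hM m) (hM m'))

open Classical in
/-- The error `ε_m(h, C_h)` of the test-set map `Ch`, defined by
`1 - ε_m(h, C_h) = inf_{p, q ∈ m} |∫_{C_h(p,q)} (p - q) dμ| / ((μ(C_h(p,q)) + h) |p - q|_h)`,
with `0 / 0` read as `1`. -/
def testError (𝒞 : Set (Set E)) (m : Set (LinfL1 μ)) (h : ℝ)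
    (Ch : LinfL1 μ → LinfL1 μ → Set E) : ℝ≥0∞ :=
  1 - ⨅ p ∈ m, ⨅ q ∈ m,
    if hNorm 𝒞 h (p - q) = 0 then 1
    else ENNReal.ofReal |mass (p - q) (Ch p q)| /
      ((μ (Ch p q) + ENNReal.ofReal h) * hNorm 𝒞 h (p - q))

/-! ### Tests, penalty and estimator

In this part a bandwidth `h` may be `∞`, because `h_p` below is a supremum over possibly infinitely
many models. The value at `∞` of a test statistic or a penalty is its limit as `h → ∞`, that is
`0`. -/

/-- The sign (in `{-1, 1}`) of `∫_C f dμ`. -/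
def massSign (f : LinfL1 μ) (C : Set E) : ℝ := if 0 ≤ mass f C then 1 else -1

/-- `T^{(h)}(x, p, q) = n⁻¹ ∑ᵢ τ_h(p,q) (P(C_h(p,q)) - 1_{C_h(p,q)}(xᵢ)) / (μ(C_h(p,q)) + h)`;
it is `0` for `h = ∞`. -/
def testStat {n : ℕ} (Csq : ℝ → LinfL1 μ → LinfL1 μ → Set E) (x : Fin n → E) (h : ℝ≥0∞)
    (p q : LinfL1 μ) : ℝ :=
  (n : ℝ)⁻¹ * ∑ i : Fin n,
    massSign (p - q) (Csq h.toReal p q) *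
      (mass p (Csq h.toReal p q) - (Csq h.toReal p q).indicator (fun _ => (1 : ℝ)) (x i)) *
      (μ (Csq h.toReal p q) + h)⁻¹.toReal

/-- `Γ = log ⌈log₂ n⌉ + log (2 ∑_{j ≤ V ∧ n} (n choose j))`. -/
def Gam (n V : ℕ) : ℝ :=
  Real.log (⌈Real.logb 2 n⌉₊ : ℝ) +
    Real.log (2 * ∑ j ∈ Finset.range (min V n + 1), (n.choose j : ℝ))

/-- `|p̂|_h = sup_{C ∈ 𝒞} #{i : xᵢ ∈ C} / (n (μ(C) + h))`; for `h > 0` it is at most `1 / h`. -/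
def empNorm {n : ℕ} (μ : Measure E) (𝒞 : Set (Set E)) (x : Fin n → E) (h : ℝ) : ℝ≥0∞ :=
  ⨆ C ∈ 𝒞, (∑ i : Fin n, C.indicator (fun _ => (1 : ℝ≥0∞)) (x i)) /
    ((n : ℝ≥0∞) * (μ C + ENNReal.ofReal h))

/-- Negative part of the logarithm. -/
def logMinus (h : ℝ) : ℝ := max 0 (-Real.log h)

/-- The penalty `pen_a(h)`, for a real bandwidth `h > 0`. -/
def pen {n : ℕ} (μ : Measure E) (𝒞 : Set (Set E)) (V : ℕ) (a : ℝ) (x : Fin n → E) (h : ℝ) : ℝ :=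
  29 * √(4 / 3) * √((empNorm μ 𝒞 x h).toReal * (Gam n V + a * logMinus h) / (h * n)) +
    √(4 / 3) * 29 ^ 2 * ((Gam n V + a * logMinus h) / (h * n))

/-- The penalty for a bandwidth in `(0, ∞]`, with `pen_a(∞) = lim_{h → ∞} pen_a(h) = 0`. -/
def penTop {n : ℕ} (μ : Measure E) (𝒞 : Set (Set E)) (V : ℕ) (a : ℝ) (x : Fin n → E)
    (h : ℝ≥0∞) : ℝ :=
  if h = ∞ then 0 else pen μ 𝒞 V a x h.toReal

/-- `h_p = sup {h_m : m ∈ ℳ, p ∈ m} ∈ (0, ∞]`. -/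
def hOf (ℳ : Set (Set (LinfL1 μ))) (hM : Set (LinfL1 μ) → ℝ) (p : LinfL1 μ) : ℝ≥0∞ :=
  ⨆ m ∈ ℳ, ⨆ _ : p ∈ m, ENNReal.ofReal (hM m)

/-- `T_ℳ(x, p) = sup_{q ∈ ⋃ ℳ} {T^{(h_p ∧ h_q)}(x, p, q) - pen_a(h_q)} + pen_a(h_p)`. -/
def selStat {n : ℕ} (𝒞 : Set (Set E)) (V : ℕ) (a : ℝ) (ℳ : Set (Set (LinfL1 μ)))
    (hM : Set (LinfL1 μ) → ℝ) (Csq : ℝ → LinfL1 μ → LinfL1 μ → Set E) (x : Fin n → E)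
    (p : LinfL1 μ) : EReal :=
  (⨆ q ∈ ⋃₀ ℳ, ((testStat Csq x (min (hOf ℳ hM p) (hOf ℳ hM q)) p q
      - penTop μ 𝒞 V a x (hOf ℳ hM q) : ℝ) : EReal))
    + ((penTop μ 𝒞 V a x (hOf ℳ hM p) : ℝ) : EReal)

/-- `phat` is a value at the sample `x` of a model selection estimator with tolerance `δ`:
it belongs to `⋃ ℳ` and minimizes `T_ℳ(x, ·)` over `⋃ ℳ` up to `δ`. -/
def IsMoshun {n : ℕ} (𝒞 : Set (Set E)) (V : ℕ) (a : ℝ) (ℳ : Set (Set (LinfL1 μ)))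
    (hM : Set (LinfL1 μ) → ℝ) (Csq : ℝ → LinfL1 μ → LinfL1 μ → Set E) (δ : ℝ) (x : Fin n → E)
    (phat : LinfL1 μ) : Prop :=
  phat ∈ ⋃₀ ℳ ∧
    selStat 𝒞 V a ℳ hM Csq x phat ≤ (⨅ p ∈ ⋃₀ ℳ, selStat 𝒞 V a ℳ hM Csq x p) + ((δ : ℝ) : EReal)

/-! ### Hypotheses and conclusion of the model selection result -/

/-- Standing assumptions on an at most countable collection `ℳ` of at most countable models, the
bandwidths `h_m > 0`, the test sets `C_h(p, q) ∈ 𝒞`, together with `κ_* > 0`. -/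
structure ModelSelectionAssumptions (𝒞 : Set (Set E)) (ℳ : Set (Set (LinfL1 μ)))
    (hM : Set (LinfL1 μ) → ℝ) (Csq : ℝ → LinfL1 μ → LinfL1 μ → Set E) : Prop where
  countable_collection : ℳ.Countable
  countable_models : ∀ m ∈ ℳ, m.Countable
  bandwidth_pos : ∀ m ∈ ℳ, 0 < hM m
  testSet_mem : ∀ h, 0 < h → ∀ p q, Csq h p q ∈ 𝒞
  kappaStar_pos : 0 < kappaStar 𝒞 ℳ hM

/-- The oracle inequality at the sample `x`, for every bound `ε < 1` on the test-set errors, every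
tolerance `δ > 0` and every value of a corresponding model selection estimator at `x`. -/
def OracleInequality {n : ℕ} (𝒞 : Set (Set E)) (V : ℕ) (a y : ℝ) (pstar : LinfL1 μ)
    (ℳ : Set (Set (LinfL1 μ))) (hM : Set (LinfL1 μ) → ℝ)
    (Csq : ℝ → LinfL1 μ → LinfL1 μ → Set E) (x : Fin n → E) : Prop :=
  ∀ (ε : ℝ≥0), ε < 1 → (⨆ (h : ℝ) (_ : 0 < h), testError 𝒞 (⋃₀ ℳ) h (Csq h)) ≤ ε →
  ∀ (δ : ℝ), 0 < δ → ∀ phat : LinfL1 μ, IsMoshun 𝒞 V a ℳ hM Csq δ x phat →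
    (1 - ε) * kappaStar 𝒞 ℳ hM * supNorm (phat - pstar) ≤
      (⨅ m ∈ ℳ, ((2 + (1 - ε) * kappaStar 𝒞 ℳ hM) * (⨅ p ∈ m, supNorm (p - pstar))
        + 4 * ENNReal.ofReal (pen μ 𝒞 V a x (hM m))))
      + ENNReal.ofReal (29 * y * √(2 * a / (3 * Real.exp 1 * n))
        + 29 ^ 2 * (4 / √3) * (a * y / (Real.exp 1 * n)) + δ)

/-- The event `Ω_x` on which, with `P* = n⁻¹ ∑ᵢ Pᵢ*`, for all `C ∈ 𝒞`,
`n⁻¹ |∑ᵢ 1_C(Xᵢ) - Pᵢ*(C)| ≤ max (29 √(P*(C)) √((Γ + x) / n)) (20 (Γ + x) / n)`. -/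
def deviationEvent {Ω : Type*} {n : ℕ} (𝒞 : Set (Set E)) (V : ℕ) (P : Fin n → Measure E)
    (X : Fin n → Ω → E) (x : ℝ) : Set Ω :=
  {ω | ∀ C ∈ 𝒞,
    (n : ℝ)⁻¹ * |∑ i : Fin n, (C.indicator (fun _ => (1 : ℝ)) (X i ω) - (P i).real C)| ≤
      max (29 * √((n : ℝ)⁻¹ * ∑ i : Fin n, (P i).real C) * √((Gam n V + x) / n))
        (20 * ((Gam n V + x) / n))}

end SupNormDensity

end

namespace SupNormDensity

/-! ### Traces of a class of sets on a finite sample -/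

/-! A relative deviation inequality gives an event of large probability, and on that event the
oracle inequality is purely deterministic.

Probability: put m = ∑ P_i(C) and L = Γ + a log y. For a countable class of VC dimension at most V,
with probability at least 1 - y^{-a}, every C satisfies |count C - m| ≤ max(16√(mL), 16L). This is
the Vapnik–Chervonenkis double-sample argument. If C violates the bound with count k, then an
independent copy with count k' satisfies (k - k')² > 4L(k + k') with probability at least 1/2
(`measure_compl_relDevEvent_le`). The X_i may have different laws, but each pair (X_i, X_i') is
exchangeable, so random swaps within pairs turn k - k' into a Rademacher sum with squared
coefficients summing to at most k + k'. Hoeffding's bound and Sauer's lemma conclude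
(`measure_discrepancyEvent_le`).

Determinism: after division by μ(C) + h, the deviation is at most pen_a(h) plus half the remainder,
for all h > 0 at once (`weighted_deviation_le`). Uniformity in h needs no union bound, because the
excess of a log y over a log_-(h) is controlled by powers of yh. Up to such errors, T(p,q) is at
most ‖p - p*‖, and (1-ε)κ_*‖p - q‖ is at most T(p,q) + ‖q - p*‖. Comparing the estimator with any p
in M then yields the inequality, the estimator's own penalty cancelling
(`oracleInequality_of_deviation`).

Countability comes either from the test sets actually compared or from the countable subclass 𝒞₀. -/

open Classical in
/-- The traces of the class `𝒞` on the sample `x`, as sets of indices. -/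
noncomputable def sampleTraces {α : Type*} {n : ℕ} (𝒞 : Set (Set α)) (x : Fin n → α) :
    Finset (Finset (Fin n)) :=
  Finset.univ.filter fun T => ∃ C ∈ 𝒞, ∀ i, i ∈ T ↔ x i ∈ C

-- The sample is injective on a shattered index set, since singletons are traces and repeated points
-- cannot be separated. Hence the image is a shattered set of points of the same size.
open Classical in
lemma card_le_of_sampleTraces_shatters {α : Type*} {n : ℕ} {𝒞 : Set (Set α)} {V : ℕ}
    (hV : vcDim 𝒞 ≤ V) {x : Fin n → α} {s : Finset (Fin n)}
    (hs : (sampleTraces 𝒞 x).Shatters s) : s.card ≤ V := by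
  have inj : Set.InjOn x s := by
    intro i hi j hj hij
    obtain ⟨u, hu, hsu⟩ := hs (t := {i}) (by simpa using hi)
    simp only [sampleTraces, Finset.mem_filter, Finset.mem_univ, true_and] at hu
    obtain ⟨C, -, hC⟩ := hu
    have hiu : i ∈ u := by
      have : i ∈ s ∩ u := by rw [hsu]; simp
      exact (Finset.mem_inter.1 this).2
    have hju : j ∈ u := by rw [hC, ← hij, ← hC]; exact hiu
    have : j ∈ s ∩ u := Finset.mem_inter.2 ⟨hj, hju⟩
    rw [hsu] at this
    exact (Finset.mem_singleton.1 this).symm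
  have hsh : Shatters 𝒞 (s.image x) := by
    intro t ht
    obtain ⟨u, hu, hsu⟩ := hs (t := s.filter fun i => x i ∈ t) (Finset.filter_subset _ _)
    simp only [sampleTraces, Finset.mem_filter, Finset.mem_univ, true_and] at hu
    obtain ⟨C, hC𝒞, hC⟩ := hu
    refine ⟨C, hC𝒞, ?_⟩
    ext z
    simp only [Finset.coe_image, Set.mem_inter_iff, Set.mem_image, Finset.mem_coe]
    constructor
    · rintro ⟨⟨i, hi, rfl⟩, hz⟩
      have : i ∈ s ∩ u := Finset.mem_inter.2 ⟨hi, (hC i).2 hz⟩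
      rw [hsu] at this
      exact (Finset.mem_filter.1 this).2
    · intro hz
      obtain ⟨i, hi, rfl⟩ := Finset.mem_image.1 (ht hz)
      have : i ∈ s ∩ u := by rw [hsu]; exact Finset.mem_filter.2 ⟨hi, hz⟩
      exact ⟨⟨i, hi, rfl⟩, (hC i).1 (Finset.mem_inter.1 this).2⟩
  have h1 : ((s.image x).card : ℕ∞) ≤ vcDim 𝒞 :=
    le_iSup₂_of_le (f := fun (s : Finset α) (_ : Shatters 𝒞 s) => (s.card : ℕ∞)) _ hsh le_rfl
  rw [Finset.card_image_of_injOn inj] at h1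
  exact_mod_cast h1.trans hV

/-- Sauer's lemma for the traces of a class of finite Vapnik-Chervonenkis dimension. -/
lemma card_sampleTraces_le {α : Type*} {n : ℕ} {𝒞 : Set (Set α)} {V : ℕ}
    (hV : vcDim 𝒞 ≤ V) (x : Fin n → α) :
    (sampleTraces 𝒞 x).card ≤ ∑ j ∈ Finset.range (min V n + 1), n.choose j := by
  classical
  refine (Finset.card_le_card_shatterer _).trans
    ((Finset.card_shatterer_le_sum_vcDim).trans ?_)
  rw [Fintype.card_fin]
  refine Finset.sum_le_sum_of_subset fun j hj => ?_
  rw [Finset.mem_Iic] at hj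
  rw [Finset.mem_range, Nat.lt_succ_iff]
  refine hj.trans (Finset.sup_le fun s hs => ?_)
  exact le_min (card_le_of_sampleTraces_shatters hV (Finset.mem_shatterer.1 hs))
    (by simpa using s.card_le_univ)

/-! ### Rademacher sums -/

/-- The sign attached to a boolean. -/
def boolSign (b : Bool) : ℝ := if b then -1 else 1

/-- The sum over signs factorizes into factors 2 cosh(t dᵢ), and cosh u ≤ exp(u²/2). -/
lemma sum_exp_signed_le {n : ℕ} (d : Fin n → ℝ) (t : ℝ) :
    ∑ σ : Fin n → Bool, Real.exp (t * ∑ i, boolSign (σ i) * d i) ≤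
      2 ^ n * Real.exp (t ^ 2 * (∑ i, d i ^ 2) / 2) := by
  have h1 : ∀ σ : Fin n → Bool, Real.exp (t * ∑ i, boolSign (σ i) * d i) =
      ∏ i, Real.exp (t * (boolSign (σ i) * d i)) := by
    intro σ
    rw [Finset.mul_sum, Real.exp_sum]
  simp_rw [h1]
  have h2 := Finset.prod_univ_sum (fun _ : Fin n => (Finset.univ : Finset Bool))
    (fun i b => Real.exp (t * (boolSign b * d i)))
  rw [Fintype.piFinset_univ] at h2
  rw [← h2]
  have h3 : ∀ i : Fin n, ∑ b : Bool, Real.exp (t * (boolSign b * d i)) ≤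
      2 * Real.exp (t ^ 2 * d i ^ 2 / 2) := by
    intro i
    have := Real.cosh_le_exp_half_sq (t * d i)
    rw [Real.cosh_eq] at this
    simp only [Fintype.sum_bool, boolSign]
    simp only [if_true, Bool.false_eq_true, if_false, neg_one_mul, one_mul, mul_neg]
    rw [mul_pow] at this
    linarith
  refine (Finset.prod_le_prod (fun i _ => by positivity) fun i _ => h3 i).trans ?_
  rw [Finset.prod_mul_distrib, ← Real.exp_sum, Finset.prod_const, Finset.card_univ,
    Fintype.card_fin, Finset.mul_sum, Finset.sum_div]

open Classical in
/-- Hoeffding's inequality for Rademacher sums, in counting form. -/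
lemma card_signed_sum_sq_gt_le {n : ℕ} (d : Fin n → ℝ) {N K : ℝ} (hN : ∑ i, d i ^ 2 ≤ N)
    (hK : 0 < K) :
    ((Finset.univ.filter fun σ : Fin n → Bool =>
      K * N < (∑ i, boolSign (σ i) * d i) ^ 2).card : ℝ) ≤ 2 * 2 ^ n * Real.exp (-(K / 2)) := by
  have hN0 : 0 ≤ N := (Finset.sum_nonneg fun i _ => sq_nonneg (d i)).trans hN
  rcases hN0.eq_or_lt with h0 | hNpos
  · have hd : ∀ i, d i = 0 := by
      intro i
      have h := (Finset.single_le_sum (f := fun i => d i ^ 2)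
        (fun i _ => sq_nonneg (d i)) (Finset.mem_univ i)).trans hN
      rw [← h0] at h
      exact pow_eq_zero_iff (two_ne_zero) |>.1 (le_antisymm h (sq_nonneg _))
    have : (Finset.univ.filter fun σ : Fin n → Bool =>
        K * N < (∑ i, boolSign (σ i) * d i) ^ 2) = ∅ := by
      apply Finset.filter_false_of_mem
      intro σ _
      simp [hd, ← h0]
    rw [this]
    simp only [Finset.card_empty, Nat.cast_zero]
    positivity
  -- The Chernoff optimum: t = s/N maximizes ts - t²N/2 at the threshold s = √(KN), where the
  -- exponent is K - K/2.
  set t := √(K / N) with ht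
  have htpos : 0 < t := Real.sqrt_pos.2 (by positivity)
  have ht2 : t ^ 2 * N = K := by
    rw [ht, Real.sq_sqrt (by positivity)]; field_simp
  have hb : ∀ r : ℝ, (∑ σ : Fin n → Bool, Real.exp ((r * t) * ∑ i, boolSign (σ i) * d i)) ≤
      2 ^ n * Real.exp (r ^ 2 * K / 2) := by
    intro r
    refine (sum_exp_signed_le d (r * t)).trans ?_
    refine mul_le_mul_of_nonneg_left (Real.exp_le_exp.2 ?_) (by positivity)
    rw [mul_pow, ← ht2]
    have : r ^ 2 * t ^ 2 * ∑ i, d i ^ 2 ≤ r ^ 2 * t ^ 2 * N := by gcongr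
    linarith
  have h1 := hb 1
  have h2 := hb (-1)
  have h3 : ((Finset.univ.filter fun σ : Fin n → Bool =>
      K * N < (∑ i, boolSign (σ i) * d i) ^ 2).card : ℝ) * Real.exp K ≤
      ∑ σ : Fin n → Bool, (Real.exp ((1 * t) * ∑ i, boolSign (σ i) * d i) +
        Real.exp ((-1 * t) * ∑ i, boolSign (σ i) * d i)) := by
    rw [← nsmul_eq_mul, ← Finset.sum_const]
    refine (Finset.sum_le_sum (g := fun σ : Fin n → Bool =>
      Real.exp ((1 * t) * ∑ i, boolSign (σ i) * d i) +
        Real.exp ((-1 * t) * ∑ i, boolSign (σ i) * d i)) fun σ hσ => ?_).trans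
      (Finset.sum_le_sum_of_subset_of_nonneg (Finset.filter_subset _ _)
        fun σ _ _ => by positivity)
    have hσ' := (Finset.mem_filter.1 hσ).2
    set S := ∑ i, boolSign (σ i) * d i
    have hS : K ≤ t * |S| := by
      have : K ^ 2 ≤ (t * |S|) ^ 2 := by
        rw [mul_pow, sq_abs]
        calc K ^ 2 = t ^ 2 * (K * N) := by rw [← ht2]; ring
          _ ≤ t ^ 2 * S ^ 2 := by gcongr
      exact abs_le_of_sq_le_sq' this (by positivity) |>.2
    rcases le_total 0 S with h | h
    · rw [abs_of_nonneg h] at hS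
      have := Real.exp_le_exp.2 hS
      have h' := Real.exp_pos (-1 * t * S)
      rw [one_mul]; linarith
    · rw [abs_of_nonpos h] at hS
      have := Real.exp_le_exp.2 hS
      have h' := Real.exp_pos (1 * t * S)
      have h'' : -1 * t * S = t * -S := by ring
      rw [h'']; linarith
  rw [Finset.sum_add_distrib] at h3
  have h4 : Real.exp (-(K / 2)) * Real.exp K = Real.exp (K / 2) := by
    rw [← Real.exp_add]; congr 1; ring
  refine le_of_mul_le_mul_right ?_ (Real.exp_pos K)
  rw [mul_assoc _ (Real.exp _), h4]
  norm_num at h1 h2 h3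
  linarith

/-! ### Swapping coordinates -/

/-- Swap the two components at the coordinates selected by `σ`. -/
def swapBy {α : Type*} {n : ℕ} (σ : Fin n → Bool) (z : Fin n → α × α) : Fin n → α × α :=
  fun i => if σ i then (z i).swap else z i

/-- Indicator difference of a pair. -/
noncomputable def pairDiff {α : Type*} (C : Set α) (z : α × α) : ℝ :=
  C.indicator (fun _ => (1 : ℝ)) z.1 - C.indicator (fun _ => (1 : ℝ)) z.2

/-- Indicator sum of a pair. -/
noncomputable def pairSum {α : Type*} (C : Set α) (z : α × α) : ℝ :=
  C.indicator (fun _ => (1 : ℝ)) z.1 + C.indicator (fun _ => (1 : ℝ)) z.2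

/-- The double samples on which some set of the class has a large relative discrepancy. -/
def discrepancyEvent {α : Type*} (n : ℕ) (𝒟 : Set (Set α)) (K : ℝ) : Set (Fin n → α × α) :=
  {z | ∃ C ∈ 𝒟, K * ∑ i, pairSum C (z i) < (∑ i, pairDiff C (z i)) ^ 2}

lemma sum_pairSum_swapBy {α : Type*} {n : ℕ} (C : Set α) (σ : Fin n → Bool)
    (z : Fin n → α × α) : ∑ i, pairSum C (swapBy σ z i) = ∑ i, pairSum C (z i) := by
  refine Finset.sum_congr rfl fun i _ => ?_
  unfold swapBy pairSum
  split_ifs <;> simp [add_comm]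

lemma sum_pairDiff_swapBy {α : Type*} {n : ℕ} (C : Set α) (σ : Fin n → Bool)
    (z : Fin n → α × α) :
    ∑ i, pairDiff C (swapBy σ z i) = ∑ i, boolSign (σ i) * pairDiff C (z i) := by
  refine Finset.sum_congr rfl fun i _ => ?_
  unfold swapBy pairDiff boolSign
  split_ifs <;> simp

-- For fixed z, whether a swap is bad depends on C only through its traces on the two half-samples.
-- A union bound over at most S² pairs of traces, S being the Sauer bound, reduces to Hoeffding for
-- one pair.
open Classical in
lemma card_swapBy_mem_discrepancyEvent_le {α : Type*} {n : ℕ} {𝒟 : Set (Set α)} {V : ℕ}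
    (hV : vcDim 𝒟 ≤ V) {K : ℝ} (hK : 0 < K) (z : Fin n → α × α) :
    ((Finset.univ.filter fun σ : Fin n → Bool =>
      swapBy σ z ∈ discrepancyEvent n 𝒟 K).card : ℝ) ≤
      (∑ j ∈ Finset.range (min V n + 1), (n.choose j : ℝ)) ^ 2 *
        (2 * 2 ^ n * Real.exp (-(K / 2))) := by
  set T₁ := sampleTraces 𝒟 (fun i => (z i).1)
  set T₂ := sampleTraces 𝒟 (fun i => (z i).2)
  let ind : Finset (Fin n) → Fin n → ℝ := fun T i => if i ∈ T then 1 else 0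
  let d : Finset (Fin n) × Finset (Fin n) → Fin n → ℝ := fun T i => ind T.1 i - ind T.2 i
  let N : Finset (Fin n) × Finset (Fin n) → ℝ := fun T => ∑ i, (ind T.1 i + ind T.2 i)
  let Bad : Finset (Fin n) × Finset (Fin n) → Finset (Fin n → Bool) := fun T =>
    Finset.univ.filter fun σ : Fin n → Bool => K * N T < (∑ i, boolSign (σ i) * d T i) ^ 2
  have hsub : (Finset.univ.filter fun σ : Fin n → Bool => swapBy σ z ∈ discrepancyEvent n 𝒟 K) ⊆
      (T₁ ×ˢ T₂).biUnion Bad := by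
    intro σ hσ
    obtain ⟨C, hC, hlt⟩ := (Finset.mem_filter.1 hσ).2
    rw [sum_pairSum_swapBy, sum_pairDiff_swapBy] at hlt
    refine Finset.mem_biUnion.2 ⟨(Finset.univ.filter fun i => (z i).1 ∈ C,
      Finset.univ.filter fun i => (z i).2 ∈ C), ?_, ?_⟩
    · simp only [T₁, T₂, sampleTraces, Finset.mem_product, Finset.mem_filter, Finset.mem_univ,
        true_and]
      exact ⟨⟨C, hC, fun _ => Iff.rfl⟩, ⟨C, hC, fun _ => Iff.rfl⟩⟩
    · simp only [Bad, N, d, ind, Finset.mem_filter, Finset.mem_univ, true_and]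
      simpa only [pairSum, pairDiff, Set.indicator_apply] using hlt
  have hBad : ∀ T ∈ T₁ ×ˢ T₂, ((Bad T).card : ℝ) ≤ 2 * 2 ^ n * Real.exp (-(K / 2)) := by
    intro T _
    -- For u, v in {0, 1}, (u - v)² ≤ u + v: the pair sums dominate the variance proxy.
    refine card_signed_sum_sq_gt_le (d T) (Finset.sum_le_sum fun i _ => ?_) hK
    simp only [d, ind]
    split_ifs <;> norm_num
  have hT₁ := card_sampleTraces_le hV (fun i => (z i).1)
  have hT₂ := card_sampleTraces_le hV (fun i => (z i).2)
  have hT₁' : (T₁.card : ℝ) ≤ ∑ j ∈ Finset.range (min V n + 1), (n.choose j : ℝ) := by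
    exact_mod_cast hT₁
  have hT₂' : (T₂.card : ℝ) ≤ ∑ j ∈ Finset.range (min V n + 1), (n.choose j : ℝ) := by
    exact_mod_cast hT₂
  calc _ ≤ (((T₁ ×ˢ T₂).biUnion Bad).card : ℝ) := by exact_mod_cast Finset.card_le_card hsub
    _ ≤ ∑ T ∈ T₁ ×ˢ T₂, ((Bad T).card : ℝ) := by exact_mod_cast Finset.card_biUnion_le
    _ ≤ ((T₁ ×ˢ T₂).card : ℝ) * (2 * 2 ^ n * Real.exp (-(K / 2))) := by
        rw [← nsmul_eq_mul, ← Finset.sum_const]; exact Finset.sum_le_sum hBad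
    _ ≤ _ := by
        rw [Finset.card_product, Nat.cast_mul, sq]
        gcongr

/-! ### Symmetrization -/

section Symmetrization

variable {E : Type*} [MeasurableSpace E]

lemma measurable_pairDiff {C : Set E} (hC : MeasurableSet C) : Measurable (pairDiff C) :=
  ((measurable_const.indicator hC).comp measurable_fst).sub
    ((measurable_const.indicator hC).comp measurable_snd)

lemma measurable_pairSum {C : Set E} (hC : MeasurableSet C) : Measurable (pairSum C) :=
  ((measurable_const.indicator hC).comp measurable_fst).add
    ((measurable_const.indicator hC).comp measurable_snd)

lemma measurableSet_discrepancyEvent {n : ℕ} {𝒟 : Set (Set E)} (hc : 𝒟.Countable)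
    (hm : ∀ C ∈ 𝒟, MeasurableSet C) (K : ℝ) : MeasurableSet (discrepancyEvent n 𝒟 K) := by
  have : discrepancyEvent n 𝒟 K = ⋃ C ∈ 𝒟, {z : Fin n → E × E |
      K * ∑ i, pairSum C (z i) < (∑ i, pairDiff C (z i)) ^ 2} := by
    ext z; simp [discrepancyEvent]
  rw [this]
  refine MeasurableSet.biUnion hc fun C hC => measurableSet_lt ?_ ?_
  · exact (Finset.measurable_sum _ fun i _ =>
      (measurable_pairSum (hm C hC)).comp (measurable_pi_apply i)).const_mul K
  · exact (Finset.measurable_sum _ fun i _ =>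
      (measurable_pairDiff (hm C hC)).comp (measurable_pi_apply i)).pow_const 2

lemma measurePreserving_swapBy {n : ℕ} (P : Fin n → Measure E) [∀ i, IsProbabilityMeasure (P i)]
    (σ : Fin n → Bool) :
    MeasurePreserving (swapBy σ) (Measure.pi fun i => (P i).prod (P i))
      (Measure.pi fun i => (P i).prod (P i)) := by
  refine measurePreserving_pi _ _ (f := fun i (z : E × E) => if σ i then z.swap else z) fun i => ?_
  cases σ i
  · simp only [Bool.false_eq_true, if_false]
    exact MeasurePreserving.id _
  · simpa using (⟨measurable_swap, Measure.prod_swap⟩ :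
      MeasurePreserving Prod.swap ((P i).prod (P i)) ((P i).prod (P i)))

/-- Every swap preserves the law of the double sample, so the probability equals its average over
the 2ⁿ swaps; the counting bound holds at each z under the integral. -/
lemma measure_discrepancyEvent_le {n : ℕ} {𝒟 : Set (Set E)} (hc : 𝒟.Countable)
    (hm : ∀ C ∈ 𝒟, MeasurableSet C) {V : ℕ} (hV : vcDim 𝒟 ≤ V) {K : ℝ} (hK : 0 < K)
    (P : Fin n → Measure E) [∀ i, IsProbabilityMeasure (P i)] :
    (Measure.pi fun i => (P i).prod (P i)) (discrepancyEvent n 𝒟 K) ≤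
      ENNReal.ofReal ((∑ j ∈ Finset.range (min V n + 1), (n.choose j : ℝ)) ^ 2 *
        (2 * Real.exp (-(K / 2)))) := by
  classical
  set ν := Measure.pi fun i => (P i).prod (P i)
  set B := discrepancyEvent n 𝒟 K
  set c := (∑ j ∈ Finset.range (min V n + 1), (n.choose j : ℝ)) ^ 2 * (2 * Real.exp (-(K / 2)))
  have hB : MeasurableSet B := measurableSet_discrepancyEvent hc hm K
  have h1 : ∀ σ : Fin n → Bool, ν B = ∫⁻ z, B.indicator 1 (swapBy σ z) ∂ν := by
    intro σ
    rw [(measurePreserving_swapBy P σ).lintegral_comp (measurable_one.indicator hB),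
      lintegral_indicator_one hB]
  have h2 : (2 : ℝ≥0∞) ^ n * ν B = ∫⁻ z, ∑ σ : Fin n → Bool, B.indicator 1 (swapBy σ z) ∂ν := by
    rw [lintegral_finsetSum (f := fun (σ : Fin n → Bool) z => B.indicator 1 (swapBy σ z)) _
      fun σ _ => (measurable_one.indicator hB).comp (measurePreserving_swapBy P σ).measurable,
      ← Finset.sum_congr rfl fun σ _ => h1 σ]
    simp
  have h3 : ∀ z, ∑ σ : Fin n → Bool, B.indicator (1 : (Fin n → E × E) → ℝ≥0∞) (swapBy σ z) ≤
      2 ^ n * ENNReal.ofReal c := by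
    intro z
    have h := card_swapBy_mem_discrepancyEvent_le hV hK z
    have h' : ∑ σ : Fin n → Bool, B.indicator (1 : (Fin n → E × E) → ℝ≥0∞) (swapBy σ z) =
        ((Finset.univ.filter fun σ : Fin n → Bool => swapBy σ z ∈ B).card : ℝ≥0∞) := by
      simp [Set.indicator_apply]
    rw [h', ← ENNReal.ofReal_natCast]
    refine (ENNReal.ofReal_le_ofReal h).trans (le_of_eq ?_)
    have : (2 : ℝ≥0∞) ^ n = ENNReal.ofReal (2 ^ n) := by
      rw [ENNReal.ofReal_pow zero_le_two]; simp
    rw [this, ← ENNReal.ofReal_mul (by positivity)]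
    congr 1
    simp only [c]; ring
  have h4 : (2 : ℝ≥0∞) ^ n * ν B ≤ 2 ^ n * ENNReal.ofReal c := by
    rw [h2]
    refine (lintegral_mono h3).trans ?_
    simp
  exact (ENNReal.mul_le_mul_iff_right (by positivity) (by finiteness)).1 h4

/-- The number of sample points in `C`. -/
noncomputable def count {n : ℕ} (C : Set E) (x : Fin n → E) : ℝ :=
  ∑ i, C.indicator (fun _ => (1 : ℝ)) (x i)

lemma measurable_count {n : ℕ} {C : Set E} (hC : MeasurableSet C) :
    Measurable (count (n := n) C) :=
  Finset.measurable_sum _ fun i _ =>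
    (measurable_const.indicator hC).comp (measurable_pi_apply i)

/-- Chebyshev: the variance of a sum of independent indicators is at most its mean. -/
lemma measure_abs_count_sub_lt_ge {n : ℕ} (P : Fin n → Measure E)
    [∀ i, IsProbabilityMeasure (P i)] {C : Set E} (hC : MeasurableSet C) {c : ℝ} (hc : 0 < c)
    (hcm : 2 * ∑ i, (P i).real C ≤ c ^ 2) :
    (1 / 2 : ℝ≥0∞) ≤ Measure.pi P {x | |count C x - ∑ i, (P i).real C| < c} := by
  let f : E → ℝ := C.indicator (fun _ => (1 : ℝ))
  have hf : Measurable f := measurable_const.indicator hC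
  let Y : Fin n → (Fin n → E) → ℝ := fun i x => f (x i)
  have hY : ∀ i, Measurable (Y i) := fun i => hf.comp (measurable_pi_apply i)
  have hYb : ∀ i x, |Y i x| ≤ 1 := by
    intro i x
    by_cases h : x i ∈ C <;> simp [Y, f, h]
  have hYL : ∀ i, MemLp (Y i) 2 (Measure.pi P) := fun i =>
    MemLp.of_bound (hY i).aestronglyMeasurable 1 (ae_of_all _ fun x => hYb i x)
  have hind : iIndepFun Y (Measure.pi P) := iIndepFun_pi fun i => hf.aemeasurable
  have hint : ∀ i, ∫ x, Y i x ∂(Measure.pi P) = (P i).real C := by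
    intro i
    rw [show (fun x => Y i x) = fun x => f (Function.eval i x) from rfl,
      ← integral_map (measurable_pi_apply i).aemeasurable
        (hf.aestronglyMeasurable), (measurePreserving_eval P i).map_eq]
    simp only [f]
    rw [integral_indicator hC]; simp
  have hvar : ∀ i, Var[Y i; Measure.pi P] ≤ (P i).real C := by
    intro i
    refine (variance_le_expectation_sq (hY i).aestronglyMeasurable).trans (le_of_eq ?_)
    rw [← hint i]
    congr 1; ext x
    by_cases h : x i ∈ C <;> simp [Y, f, h]
  have hsum : (count C : (Fin n → E) → ℝ) = ∑ i, Y i := by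
    ext x; simp [count, Y, f]
  have hE : ∫ x, count C x ∂(Measure.pi P) = ∑ i, (P i).real C := by
    simp only [count]
    rw [integral_finsetSum _ fun i _ => (hYL i).integrable one_le_two]
    exact Finset.sum_congr rfl fun i _ => hint i
  have hV : Var[count C; Measure.pi P] ≤ ∑ i, (P i).real C := by
    rw [hsum, IndepFun.variance_sum (fun i _ => hYL i)
      (fun i _ j _ hij => hind.indepFun hij)]
    exact Finset.sum_le_sum fun i _ => hvar i
  have hL : MemLp (count C) 2 (Measure.pi P) := by
    rw [hsum]; exact memLp_finsetSum' _ fun i _ => hYL i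
  have hcheb := meas_ge_le_variance_div_sq hL hc
  rw [hE] at hcheb
  have hhalf : ENNReal.ofReal (Var[count C; Measure.pi P] / c ^ 2) ≤ 1 / 2 := by
    rw [show (1 / 2 : ℝ≥0∞) = ENNReal.ofReal (1 / 2) by
      rw [ENNReal.ofReal_div_of_pos two_pos]; simp]
    refine ENNReal.ofReal_le_ofReal ?_
    rw [div_le_iff₀ (by positivity)]
    linarith
  have hmeas : MeasurableSet {x : Fin n → E | c ≤ |count C x - ∑ i, (P i).real C|} :=
    measurableSet_le measurable_const ((measurable_count hC).sub_const _).abs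
  have hcompl : {x : Fin n → E | |count C x - ∑ i, (P i).real C| < c} =
      {x | c ≤ |count C x - ∑ i, (P i).real C|}ᶜ := by
    ext x; simp
  rw [hcompl, prob_compl_eq_one_sub hmeas]
  refine le_trans ?_ (tsub_le_tsub_left (hcheb.trans hhalf) 1)
  rw [one_div, ENNReal.one_sub_inv_two]

/-- The samples on which the class satisfies a relative deviation bound at level `L`. -/
def relDevEvent {n : ℕ} (𝒟 : Set (Set E)) (P : Fin n → Measure E) (L : ℝ) : Set (Fin n → E) :=
  {x | ∀ C ∈ 𝒟, |count C x - ∑ i, (P i).real C| ≤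
    max (16 * √((∑ i, (P i).real C) * L)) (16 * L)}

lemma measurableSet_relDevEvent {n : ℕ} {𝒟 : Set (Set E)} (hc : 𝒟.Countable)
    (hm : ∀ C ∈ 𝒟, MeasurableSet C) (P : Fin n → Measure E) (L : ℝ) :
    MeasurableSet (relDevEvent 𝒟 P L) := by
  have : relDevEvent 𝒟 P L = ⋂ C ∈ 𝒟, {x : Fin n → E | |count C x - ∑ i, (P i).real C| ≤
    max (16 * √((∑ i, (P i).real C) * L)) (16 * L)} := by
    ext x; simp [relDevEvent]
  rw [this]
  exact MeasurableSet.biInter hc fun C hC =>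
    measurableSet_le ((measurable_count (hm C hC)).sub_const _).abs measurable_const

/-- A large relative deviation persists against a typical independent copy. -/
lemma sq_discrepancy_gt {k k' m L c : ℝ} (hm : 0 ≤ m) (hL : 1 / 2 ≤ L) 
    (hc2 : c ^ 2 = 2 * m + L) (hk : max (16 * √(m * L)) (16 * L) < |k - m|)
    (hk' : |k' - m| < c) : 4 * L * (k + k') < (k - k') ^ 2 := by
  obtain ⟨h1, h2⟩ := max_lt_iff.1 hk
  set D := |k - m| with hD
  have hD0 : 0 < D := by linarith
  have h3 : 256 * (m * L) ≤ D ^ 2 := by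
    have hs := Real.sq_sqrt (show 0 ≤ m * L by positivity)
    have := Real.sqrt_nonneg (m * L)
    nlinarith
  -- L ≥ 1/2 turns the bounds on mL and L² into bounds on m and L; then c² ≤ 3D²/128 ≤ (D/6)².
  -- Finally 4L(k + k') ≤ (1/32 + 7/24)D², which is below (25/36)D².
  have h4 : 128 * m ≤ D ^ 2 := by nlinarith
  have h5 : 128 * L ≤ D ^ 2 := by nlinarith
  have h6 : c ≤ D / 6 := by
    refine abs_le_of_sq_le_sq' ?_ (by positivity) |>.2
    nlinarith
  have h7 : k - m ≤ D := le_abs_self _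
  have h8 := abs_lt.1 hk'
  have h9 : k + k' ≤ 2 * m + 7 / 6 * D := by linarith
  have h10 : 4 * L * (k + k') ≤ 8 * (m * L) + 14 / 3 * (L * D) := by nlinarith
  have h11 : L * D ≤ D ^ 2 / 16 := by nlinarith
  have h12 : 5 / 6 * D ≤ |k - k'| := by
    have : D ≤ |k - k'| + |k' - m| := by
      rw [hD]; exact abs_sub_le k k' m
    linarith
  have h13 : (5 / 6 * D) ^ 2 ≤ (k - k') ^ 2 := by
    rw [← sq_abs (k - k')]; gcongr
  nlinarith [mul_pos hD0 hD0]

/-- For each bad sample, fix one violating set: the copy is near its mean on that set with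
probability at least 1/2. Fubini, after regrouping n pairs as a pair of n-samples, costs the factor
2. -/
lemma measure_compl_relDevEvent_le {n : ℕ} {𝒟 : Set (Set E)} (hc : 𝒟.Countable)
    (hm : ∀ C ∈ 𝒟, MeasurableSet C) (P : Fin n → Measure E) [∀ i, IsProbabilityMeasure (P i)]
    {L : ℝ} (hL : 1 / 2 ≤ L) :
    Measure.pi P (relDevEvent 𝒟 P L)ᶜ ≤
      2 * (Measure.pi fun i => (P i).prod (P i)) (discrepancyEvent n 𝒟 (4 * L)) := by
  set B := discrepancyEvent n 𝒟 (4 * L)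
  have hB : MeasurableSet B := measurableSet_discrepancyEvent hc hm _
  set Φ := MeasurableEquiv.arrowProdEquivProdArrow E E (Fin n)
  have hΦ := measurePreserving_arrowProdEquivProdArrow E E (Fin n) P P
  have h1 : (Measure.pi fun i => (P i).prod (P i)) B =
      ((Measure.pi P).prod (Measure.pi P)) (Φ.symm ⁻¹' B) := by
    rw [← hΦ.measure_preimage (Φ.symm.measurable hB).nullMeasurableSet]
    congr 1
  have hG : MeasurableSet (relDevEvent 𝒟 P L)ᶜ := (measurableSet_relDevEvent hc hm P L).compl
  have h2 : ∀ x ∈ (relDevEvent 𝒟 P L)ᶜ,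
      (1 / 2 : ℝ≥0∞) ≤ Measure.pi P (Prod.mk x ⁻¹' (Φ.symm ⁻¹' B)) := by
    intro x hx
    simp only [relDevEvent, Set.mem_compl_iff, Set.mem_ofPred_eq, not_forall, not_le] at hx
    obtain ⟨C, hC, hlt⟩ := hx
    set m := ∑ i, (P i).real C
    have hm0 : 0 ≤ m := Finset.sum_nonneg fun i _ => measureReal_nonneg
    have hcpos : 0 < √(2 * m + L) := Real.sqrt_pos.2 (by linarith)
    have hc2 : √(2 * m + L) ^ 2 = 2 * m + L := Real.sq_sqrt (by linarith)
    refine (measure_abs_count_sub_lt_ge P (hm C hC) hcpos (by linarith)).trans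
      (measure_mono fun x' hx' => ?_)
    have h := sq_discrepancy_gt hm0 hL hc2 hlt hx'
    refine ⟨C, hC, ?_⟩
    rw [count, count, ← Finset.sum_add_distrib, ← Finset.sum_sub_distrib] at h
    exact h
  rw [h1, Measure.prod_apply (Φ.symm.measurable hB)]
  have h3 : (1 / 2 : ℝ≥0∞) * Measure.pi P (relDevEvent 𝒟 P L)ᶜ ≤
      ∫⁻ x, Measure.pi P (Prod.mk x ⁻¹' (Φ.symm ⁻¹' B)) ∂(Measure.pi P) := by
    rw [← setLIntegral_const]
    exact (setLIntegral_mono' hG h2).trans (setLIntegral_le_lintegral _ _)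
  calc Measure.pi P (relDevEvent 𝒟 P L)ᶜ
      = 2 * ((1 / 2 : ℝ≥0∞) * Measure.pi P (relDevEvent 𝒟 P L)ᶜ) := by
        rw [← mul_assoc, one_div, ENNReal.mul_inv_cancel two_ne_zero (by finiteness), one_mul]
    _ ≤ _ := by gcongr

end Symmetrization

/-! ### The deviation event -/

lemma one_le_sum_choose (n V : ℕ) :
    (1 : ℝ) ≤ ∑ j ∈ Finset.range (min V n + 1), (n.choose j : ℝ) := by
  have := Finset.single_le_sum (f := fun j => (n.choose j : ℝ)) (fun j _ => Nat.cast_nonneg _)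
    (Finset.mem_range.2 (Nat.succ_pos (min V n)))
  simpa using this

lemma log_sum_le_Gam (n V : ℕ) :
    Real.log (2 * ∑ j ∈ Finset.range (min V n + 1), (n.choose j : ℝ)) ≤ Gam n V := by
  unfold Gam
  have : 0 ≤ Real.log (⌈Real.logb 2 n⌉₊ : ℝ) := Real.log_natCast_nonneg _
  linarith

lemma half_le_Gam (n V : ℕ) : 1 / 2 ≤ Gam n V := by
  refine le_trans ?_ (log_sum_le_Gam n V)
  have h1 := one_le_sum_choose n V
  have h2 : Real.log 2 ≤ Real.log (2 * ∑ j ∈ Finset.range (min V n + 1), (n.choose j : ℝ)) :=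
    Real.log_le_log two_pos (by linarith)
  have := Real.log_two_gt_d9
  linarith

lemma one_sub_exp_le_measureReal_relDevEvent {E Ω : Type*} [MeasurableSpace E]
    [MeasurableSpace Ω] {n : ℕ} {𝒟 : Set (Set E)} (hc : 𝒟.Countable)
    (hm : ∀ C ∈ 𝒟, MeasurableSet C) {V : ℕ} (hV : vcDim 𝒟 ≤ V)
    (Pr : Measure Ω) [IsProbabilityMeasure Pr] {X : Fin n → Ω → E} (hX : ∀ i, Measurable (X i))
    (hindep : iIndepFun X Pr) {x : ℝ} (hx : 0 ≤ x) :
    1 - Real.exp (-x) ≤ Pr.real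
      ((fun ω i => X i ω) ⁻¹' relDevEvent 𝒟 (fun i => Pr.map (X i)) (Gam n V + x)) := by
  set P := fun i => Pr.map (X i)
  have hP : ∀ i, IsProbabilityMeasure (P i) := fun i =>
    Measure.isProbabilityMeasure_map (hX i).aemeasurable
  set L := Gam n V + x
  set S := ∑ j ∈ Finset.range (min V n + 1), (n.choose j : ℝ)
  have hS : 1 ≤ S := one_le_sum_choose n V
  have hL : 1 / 2 ≤ L := by have := half_le_Gam n V; simp only [L]; linarith
  have hmX : Measurable fun ω i => X i ω := measurable_pi_lambda _ hX
  have hG := measurableSet_relDevEvent hc hm P L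
  have hmap := (iIndepFun_iff_map_fun_eq_pi_map fun i => (hX i).aemeasurable).1 hindep
  have h1 : Pr ((fun ω i => X i ω) ⁻¹' relDevEvent 𝒟 P L)ᶜ ≤ ENNReal.ofReal (Real.exp (-x)) := by
    rw [← Set.preimage_compl, ← Measure.map_apply hmX hG.compl, hmap]
    refine (measure_compl_relDevEvent_le hc hm P hL).trans ?_
    refine (mul_le_mul_right (measure_discrepancyEvent_le hc hm hV (by linarith) P) 2).trans ?_
    rw [show (2 : ℝ≥0∞) = ENNReal.ofReal 2 by simp, ← ENNReal.ofReal_mul zero_le_two]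
    refine ENNReal.ofReal_le_ofReal ?_
    -- The total prefactor is 2 · 2S² = (2S)², cancelled exactly by two copies of log(2S) ≤ Γ;
    -- exp(-2x) is weakened to exp(-x).
    have hexp : Real.exp (-(4 * L / 2)) ≤ ((2 * S) ^ 2)⁻¹ * Real.exp (-x) := by
      have h2 : Real.log (2 * S) ≤ Gam n V := log_sum_le_Gam n V
      rw [← Real.exp_log (show (0 : ℝ) < 2 * S by linarith), ← Real.exp_nat_mul, ← Real.exp_neg,
        ← Real.exp_add]
      refine Real.exp_le_exp.2 ?_
      simp only [L]; push_cast; linarith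
    calc 2 * (S ^ 2 * (2 * Real.exp (-(4 * L / 2))))
        ≤ 2 * (S ^ 2 * (2 * (((2 * S) ^ 2)⁻¹ * Real.exp (-x)))) := by gcongr
      _ = Real.exp (-x) := by field_simp
  have h3 : Pr.real ((fun ω i => X i ω) ⁻¹' relDevEvent 𝒟 P L)ᶜ ≤ Real.exp (-x) :=
    ENNReal.toReal_le_of_le_ofReal (Real.exp_pos _).le h1
  rw [probReal_compl_eq_one_sub (hmX hG)] at h3
  linarith

section Deterministic

variable {E : Type*} [MeasurableSpace E] {μ : Measure E}

/-! ### Integrals over sets and norms -/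

lemma integrable_coe (f : LinfL1 μ) : Integrable (f : E →ₘ[μ] ℝ) μ :=
  memLp_one_iff_integrable.1 (Lp.mem_Lp_iff_memLp.1 f.2.2)

lemma supNorm_ne_top (f : LinfL1 μ) : supNorm f ≠ ∞ :=
  (Lp.mem_Lp_iff_eLpNorm_lt_top.1 f.2.1).ne

lemma supNorm_zero : supNorm (0 : LinfL1 μ) = 0 := by
  unfold supNorm
  rw [ZeroMemClass.coe_zero, eLpNorm_congr_ae AEEqFun.coeFn_zero, eLpNorm_zero]

/-- `f ↦ ∫_C f dμ` as a linear form. -/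
noncomputable def massLin (C : Set E) : LinfL1 μ →ₗ[ℝ] ℝ where
  toFun f := mass f C
  map_add' f g := by
    unfold mass
    rw [← integral_add (integrable_coe f).integrableOn (integrable_coe g).integrableOn]
    exact integral_congr_ae (ae_restrict_of_ae (AEEqFun.coeFn_add _ _))
  map_smul' c f := by
    unfold mass
    rw [RingHom.id_apply, smul_eq_mul, ← integral_const_mul]
    exact integral_congr_ae (ae_restrict_of_ae (AEEqFun.coeFn_smul _ _))

lemma massLin_apply (C : Set E) (f : LinfL1 μ) : massLin C f = mass f C := rfl

lemma mass_sub (f g : LinfL1 μ) (C : Set E) : mass (f - g) C = mass f C - mass g C :=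
  (massLin C).map_sub f g

lemma mass_average {n : ℕ} (f : Fin n → LinfL1 μ) (C : Set E) :
    mass ((n : ℝ)⁻¹ • ∑ i, f i) C = (n : ℝ)⁻¹ * ∑ i, mass (f i) C := by
  rw [← massLin_apply, map_smul, map_sum]; rfl

lemma abs_mass_le_integral (f : LinfL1 μ) (C : Set E) :
    |mass f C| ≤ ∫ x, |(f : E →ₘ[μ] ℝ) x| ∂μ :=
  (norm_integral_le_integral_norm _).trans
    (setIntegral_le_integral (integrable_coe f).norm (ae_of_all _ fun _ => norm_nonneg _))

lemma ofReal_abs_mass_le (f : LinfL1 μ) (C : Set E) :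
    ENNReal.ofReal |mass f C| ≤ supNorm f * μ C := by
  rw [← Real.enorm_eq_ofReal_abs]
  refine (enorm_integral_le_lintegral_enorm _).trans ?_
  rw [← setLIntegral_const]
  refine lintegral_mono_ae (ae_restrict_of_ae ?_)
  unfold supNorm
  rw [eLpNorm_exponent_top]
  exact enorm_ae_le_eLpNormEssSup _ _

lemma ofReal_abs_mass_div_le (f : LinfL1 μ) (C : Set E) (h : ℝ≥0∞) :
    ENNReal.ofReal |mass f C| / (μ C + h) ≤ supNorm f :=
  ENNReal.div_le_of_le_mul ((ofReal_abs_mass_le f C).trans (by gcongr; exact le_self_add))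

lemma abs_mass_mul_le (f : LinfL1 μ) (C : Set E) (h : ℝ≥0∞) :
    |mass f C| * (μ C + h)⁻¹.toReal ≤ (supNorm f).toReal := by
  have := ENNReal.toReal_mono (supNorm_ne_top f) (ofReal_abs_mass_div_le f C h)
  rwa [div_eq_mul_inv, ENNReal.toReal_mul, ENNReal.toReal_ofReal (abs_nonneg _)] at this

lemma hNorm_le_supNorm (𝒞 : Set (Set E)) (h : ℝ) (f : LinfL1 μ) : hNorm 𝒞 h f ≤ supNorm f :=
  iSup₂_le fun C _ => ofReal_abs_mass_div_le f C _

lemma hNorm_antitone (𝒞 : Set (Set E)) (f : LinfL1 μ) : Antitone fun h => hNorm 𝒞 h f :=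
  fun _ _ hh => iSup₂_mono fun _ _ => by gcongr

lemma hNorm_le_integral_div (𝒞 : Set (Set E)) {h : ℝ} (hh : 0 < h) (f : LinfL1 μ) :
    hNorm 𝒞 h f ≤ ENNReal.ofReal ((∫ x, |(f : E →ₘ[μ] ℝ) x| ∂μ) / h) := by
  refine iSup₂_le fun C _ => ?_
  rw [ENNReal.ofReal_div_of_pos hh]
  gcongr
  · exact abs_mass_le_integral f C
  · exact le_add_self

/-- Since μ(C) + h/r ≥ (μ(C) + h)/r. This supplies the continuity in h needed when the supremum
defining h_p is not attained. -/
lemma hNorm_div_le (𝒞 : Set (Set E)) {h r : ℝ} (hr : 1 ≤ r) (f : LinfL1 μ) :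
    hNorm 𝒞 (h / r) f ≤ ENNReal.ofReal r * hNorm 𝒞 h f := by
  have hr0 : 0 < r := by linarith
  refine iSup₂_le fun C hC => ?_
  have h1 : ENNReal.ofReal |mass f C| / (μ C + ENNReal.ofReal h) ≤ hNorm 𝒞 h f :=
    le_iSup₂ (f := fun (C : Set E) (_ : C ∈ 𝒞) =>
      ENNReal.ofReal |mass f C| / (μ C + ENNReal.ofReal h)) C hC
  refine le_trans ?_ (mul_le_mul_right h1 _)
  have h0 : ENNReal.ofReal r ≠ 0 := by simpa using hr0
  have h2 : (μ C + ENNReal.ofReal (h / r))⁻¹ ≤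
      ENNReal.ofReal r * (μ C + ENNReal.ofReal h)⁻¹ := by
    rw [← ENNReal.inv_le_inv, inv_inv, ENNReal.mul_inv (Or.inl h0) (Or.inl ENNReal.ofReal_ne_top),
      inv_inv, mul_comm, ← div_eq_mul_inv]
    refine ENNReal.div_le_of_le_mul ?_
    rw [add_mul, ← ENNReal.ofReal_mul' hr0.le, div_mul_cancel₀ _ hr0.ne']
    gcongr
    exact le_mul_of_one_le_right' (by simpa using hr)
  rw [div_eq_mul_inv _ (μ C + ENNReal.ofReal (h / r)), div_eq_mul_inv _ (μ C + ENNReal.ofReal h)]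
  calc _ ≤ ENNReal.ofReal |mass f C| * (ENNReal.ofReal r * (μ C + ENNReal.ofReal h)⁻¹) :=
        mul_le_mul_right h2 _
    _ = _ := by ring

/-! ### Bandwidths of densities and `κ_*` -/

lemma kappaStar_mul_supNorm_le_of_mem {𝒞 : Set (Set E)} {ℳ : Set (Set (LinfL1 μ))}
    {hM : Set (LinfL1 μ) → ℝ} {m m' : Set (LinfL1 μ)} (hm : m ∈ ℳ) (hm' : m' ∈ ℳ)
    {p q : LinfL1 μ} (hp : p ∈ m) (hq : q ∈ m') :
    kappaStar 𝒞 ℳ hM * supNorm (p - q) ≤ hNorm 𝒞 (min (hM m) (hM m')) (p - q) := by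
  classical
  by_cases hpq : p = q
  · rw [hpq, sub_self, supNorm_zero, mul_zero]; exact zero_le
  refine ENNReal.mul_le_of_le_div ?_
  have h1 : kappaStar 𝒞 ℳ hM ≤ kappa 𝒞 (m ∪ m') (min (hM m) (hM m')) :=
    (iInf₂_le m hm).trans (iInf₂_le m' hm')
  refine h1.trans (((iInf₂_le p (Or.inl hp)).trans (iInf₂_le q (Or.inr hq))).trans ?_)
  rw [if_neg hpq]

lemma ofReal_le_hOf {ℳ : Set (Set (LinfL1 μ))} (hM : Set (LinfL1 μ) → ℝ)
    {m : Set (LinfL1 μ)} (hm : m ∈ ℳ) {p : LinfL1 μ} (hp : p ∈ m) :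
    ENNReal.ofReal (hM m) ≤ hOf ℳ hM p := by
  unfold hOf
  exact le_iSup₂_of_le m hm (le_iSup_of_le hp le_rfl)

lemma exists_of_lt_hOf {ℳ : Set (Set (LinfL1 μ))} {hM : Set (LinfL1 μ) → ℝ}
    {t : ℝ} {p : LinfL1 μ} (h : ENNReal.ofReal t < hOf ℳ hM p) :
    ∃ m ∈ ℳ, p ∈ m ∧ t < hM m := by
  unfold hOf at h
  simp only [lt_iSup_iff] at h
  obtain ⟨m, hm, hp, hlt⟩ := h
  exact ⟨m, hm, hp, lt_of_not_ge fun hle => hlt.not_ge (ENNReal.ofReal_le_ofReal hle)⟩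

lemma kappaStar_mul_supNorm_le_of_lt {𝒞 : Set (Set E)} {ℳ : Set (Set (LinfL1 μ))}
    {hM : Set (LinfL1 μ) → ℝ} {p q : LinfL1 μ} {t : ℝ}
    (ht : ENNReal.ofReal t < min (hOf ℳ hM p) (hOf ℳ hM q)) :
    kappaStar 𝒞 ℳ hM * supNorm (p - q) ≤ hNorm 𝒞 t (p - q) := by
  obtain ⟨hp, hq⟩ := lt_min_iff.1 ht
  obtain ⟨m, hm, hpm, h1⟩ := exists_of_lt_hOf hp
  obtain ⟨m', hm', hqm, h2⟩ := exists_of_lt_hOf hq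
  exact (kappaStar_mul_supNorm_le_of_mem hm hm' hpm hqm).trans
    (hNorm_antitone 𝒞 _ (le_min h1.le h2.le))

/-- Models of arbitrarily large bandwidth contain p and q, and |f|_t ≤ ‖f‖₁/t tends to 0. This
justifies the value 0 of the test at h = ∞. -/
lemma kappaStar_mul_supNorm_eq_zero {𝒞 : Set (Set E)} {ℳ : Set (Set (LinfL1 μ))}
    {hM : Set (LinfL1 μ) → ℝ} {p q : LinfL1 μ}
    (htop : min (hOf ℳ hM p) (hOf ℳ hM q) = ∞) :
    kappaStar 𝒞 ℳ hM * supNorm (p - q) = 0 := by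
  have hlim : Filter.Tendsto (fun t : ℝ => ENNReal.ofReal
      ((∫ x, |((p - q : LinfL1 μ) : E →ₘ[μ] ℝ) x| ∂μ) / t)) Filter.atTop (nhds 0) := by
    simpa using ENNReal.tendsto_ofReal (Filter.Tendsto.const_div_atTop Filter.tendsto_id _)
  refine le_antisymm (ge_of_tendsto hlim ?_) (zero_le)
  filter_upwards [Filter.eventually_gt_atTop 0] with t ht
  exact (kappaStar_mul_supNorm_le_of_lt (by rw [htop]; exact ENNReal.ofReal_lt_top)).trans
    (hNorm_le_integral_div 𝒞 ht _)

/-- Apply the strict case at h/r and let r decrease to 1. -/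
lemma kappaStar_mul_supNorm_le {𝒞 : Set (Set E)} {ℳ : Set (Set (LinfL1 μ))}
    {hM : Set (LinfL1 μ) → ℝ} {p q : LinfL1 μ} {h : ℝ} (hh : 0 < h)
    (hmin : min (hOf ℳ hM p) (hOf ℳ hM q) = ENNReal.ofReal h) :
    kappaStar 𝒞 ℳ hM * supNorm (p - q) ≤ hNorm 𝒞 h (p - q) := by
  set f := p - q
  have hfin : hNorm 𝒞 h f ≠ ∞ := ne_top_of_le_ne_top (supNorm_ne_top f) (hNorm_le_supNorm 𝒞 h f)
  have hlim : Filter.Tendsto (fun r : ℝ => ENNReal.ofReal r * hNorm 𝒞 h f)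
      (nhdsWithin 1 (Set.Ioi 1)) (nhds (hNorm 𝒞 h f)) := by
    have := ENNReal.Tendsto.mul_const (b := hNorm 𝒞 h f) (ENNReal.tendsto_ofReal
      (Filter.tendsto_id.mono_left (nhdsWithin_le_nhds (a := (1 : ℝ)) (s := Set.Ioi 1))))
      (Or.inr hfin)
    simpa using this
  refine ge_of_tendsto hlim ?_
  filter_upwards [self_mem_nhdsWithin] with r hr
  have hr : 1 < r := hr
  refine (kappaStar_mul_supNorm_le_of_lt (t := h / r) ?_).trans (hNorm_div_le 𝒞 hr.le f)
  rw [hmin, ENNReal.ofReal_lt_ofReal_iff hh]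
  exact div_lt_self hh hr

/-! ### Test sets -/

lemma one_sub_mul_hNorm_le {𝒞 : Set (Set E)} {M : Set (LinfL1 μ)} {h : ℝ}
    {Ch : LinfL1 μ → LinfL1 μ → Set E} {ε : ℝ≥0∞} (hε : testError 𝒞 M h Ch ≤ ε)
    {p q : LinfL1 μ} (hp : p ∈ M) (hq : q ∈ M) :
    (1 - ε) * hNorm 𝒞 h (p - q) ≤
      ENNReal.ofReal |mass (p - q) (Ch p q)| / (μ (Ch p q) + ENNReal.ofReal h) := by
  classical
  by_cases h0 : hNorm 𝒞 h (p - q) = 0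
  · rw [h0, mul_zero]; exact zero_le
  have hfin : hNorm 𝒞 h (p - q) ≠ ∞ :=
    ne_top_of_le_ne_top (supNorm_ne_top _) (hNorm_le_supNorm 𝒞 h _)
  have h1 : 1 - ε ≤ ENNReal.ofReal |mass (p - q) (Ch p q)| /
      ((μ (Ch p q) + ENNReal.ofReal h) * hNorm 𝒞 h (p - q)) := by
    unfold testError at hε
    refine (tsub_le_iff_tsub_le.1 hε).trans ((iInf₂_le p hp).trans ((iInf₂_le q hq).trans ?_))
    rw [if_neg h0]
  refine (mul_le_mul_left h1 _).trans (le_of_eq ?_)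
  rw [div_eq_mul_inv, ENNReal.mul_inv (Or.inr hfin) (Or.inr h0), mul_assoc, mul_assoc,
    ENNReal.inv_mul_cancel h0 hfin, mul_one, div_eq_mul_inv]

lemma abs_massSign (f : LinfL1 μ) (C : Set E) : |massSign f C| = 1 := by
  unfold massSign; split_ifs <;> simp

lemma massSign_mul_mass (f : LinfL1 μ) (C : Set E) : massSign f C * mass f C = |mass f C| := by
  unfold massSign
  split_ifs with h
  · rw [one_mul, abs_of_nonneg h]
  · rw [neg_one_mul, abs_of_neg (not_le.1 h)]

lemma testStat_eq {n : ℕ} (hn : n ≠ 0) (Csq : ℝ → LinfL1 μ → LinfL1 μ → Set E) (x : Fin n → E)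
    (h : ℝ≥0∞) (p q : LinfL1 μ) :
    testStat Csq x h p q = massSign (p - q) (Csq h.toReal p q) *
      (mass p (Csq h.toReal p q) - (n : ℝ)⁻¹ * count (Csq h.toReal p q) x) *
        (μ (Csq h.toReal p q) + h)⁻¹.toReal := by
  have hn' : (n : ℝ) ≠ 0 := by exact_mod_cast hn
  unfold testStat count
  rw [← Finset.sum_mul, ← Finset.mul_sum, Finset.sum_sub_distrib, Finset.sum_const,
    Finset.card_univ, Fintype.card_fin, nsmul_eq_mul]
  field_simp

lemma testStat_top {n : ℕ} (Csq : ℝ → LinfL1 μ → LinfL1 μ → Set E) (x : Fin n → E)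
    (p q : LinfL1 μ) : testStat Csq x ∞ p q = 0 := by
  simp [testStat]

/-- Bias plus fluctuation: insert the mass of r, later p*, between the mass of p and the empirical
frequency. -/
lemma testStat_le {n : ℕ} (hn : n ≠ 0) (Csq : ℝ → LinfL1 μ → LinfL1 μ → Set E) (x : Fin n → E)
    (h : ℝ≥0∞) (p q r : LinfL1 μ) :
    testStat Csq x h p q ≤ (supNorm (p - r)).toReal +
      |mass r (Csq h.toReal p q) - (n : ℝ)⁻¹ * count (Csq h.toReal p q) x| *
        (μ (Csq h.toReal p q) + h)⁻¹.toReal := by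
  rw [testStat_eq hn]
  set C := Csq h.toReal p q
  set w := (μ C + h)⁻¹.toReal with hw
  have hw0 : 0 ≤ w := ENNReal.toReal_nonneg
  have h1 := abs_mass_mul_le (p - r) C h
  rw [mass_sub] at h1
  have hs := abs_massSign (p - q) C
  calc massSign (p - q) C * (mass p C - (n : ℝ)⁻¹ * count C x) * w
      ≤ |mass p C - (n : ℝ)⁻¹ * count C x| * w := by
        refine mul_le_mul_of_nonneg_right ((le_abs_self _).trans ?_) hw0
        rw [abs_mul, hs, one_mul]
    _ ≤ (|mass p C - mass r C| + |mass r C - (n : ℝ)⁻¹ * count C x|) * w := by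
        gcongr; exact abs_sub_le _ _ _
    _ ≤ _ := by rw [add_mul]; gcongr

/-- The sign makes τ∫_C(p - q) nonnegative; writing p - q as (p - empirical) - (q - empirical)
isolates the test. -/
lemma abs_mass_mul_le_testStat {n : ℕ} (hn : n ≠ 0) (Csq : ℝ → LinfL1 μ → LinfL1 μ → Set E)
    (x : Fin n → E) (h : ℝ≥0∞) (p q r : LinfL1 μ) :
    |mass (p - q) (Csq h.toReal p q)| * (μ (Csq h.toReal p q) + h)⁻¹.toReal ≤
      testStat Csq x h p q + (supNorm (q - r)).toReal +
      |mass r (Csq h.toReal p q) - (n : ℝ)⁻¹ * count (Csq h.toReal p q) x| *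
        (μ (Csq h.toReal p q) + h)⁻¹.toReal := by
  rw [testStat_eq hn]
  set C := Csq h.toReal p q
  set w := (μ C + h)⁻¹.toReal with hw
  have hw0 : 0 ≤ w := ENNReal.toReal_nonneg
  have h1 := abs_mass_mul_le (q - r) C h
  rw [mass_sub] at h1
  have hs := abs_massSign (p - q) C
  set σ := massSign (p - q) C
  have h2 : -σ * (mass q C - (n : ℝ)⁻¹ * count C x) ≤
      |mass q C - mass r C| + |mass r C - (n : ℝ)⁻¹ * count C x| := by
    refine (le_abs_self _).trans ?_
    rw [abs_mul, abs_neg, hs, one_mul]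
    exact abs_sub_le _ _ _
  have h3 := mul_le_mul_of_nonneg_right h2 hw0
  rw [← massSign_mul_mass, mass_sub]
  linarith

end Deterministic

/-! ### The empirical norm and the penalty -/

lemma ofReal_count {α : Type*} {n : ℕ} (C : Set α) (x : Fin n → α) :
    ENNReal.ofReal (count C x) = ∑ i : Fin n, C.indicator (fun _ => (1 : ℝ≥0∞)) (x i) := by
  unfold count
  rw [ENNReal.ofReal_sum_of_nonneg fun i _ => Set.indicator_nonneg (fun _ _ => zero_le_one) _]
  refine Finset.sum_congr rfl fun i _ => ?_
  by_cases h : x i ∈ C <;> simp [h]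

lemma count_nonneg {α : Type*} {n : ℕ} (C : Set α) (x : Fin n → α) : 0 ≤ count C x :=
  Finset.sum_nonneg fun _ _ => Set.indicator_nonneg (fun _ _ => zero_le_one) _

section Penalty

variable {E : Type*} [MeasurableSpace E] {μ : Measure E}

lemma empNorm_le {n : ℕ} (hn : n ≠ 0) (𝒞 : Set (Set E)) (x : Fin n → E) {h : ℝ} (hh : 0 < h) :
    empNorm μ 𝒞 x h ≤ ENNReal.ofReal (1 / h) := by
  have hn' : (n : ℝ≥0∞) ≠ 0 := by exact_mod_cast hn
  refine iSup₂_le fun C _ => ?_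
  have h1 : ∑ i : Fin n, C.indicator (fun _ => (1 : ℝ≥0∞)) (x i) ≤ n := by
    refine (Finset.sum_le_sum (g := fun _ => (1 : ℝ≥0∞)) fun i _ => ?_).trans (by simp)
    exact Set.indicator_le_self' (fun _ _ => zero_le) _
  calc _ ≤ (n : ℝ≥0∞) * 1 / ((n : ℝ≥0∞) * ENNReal.ofReal h) := by
        rw [mul_one]; gcongr; exact le_add_self
    _ = 1 / ENNReal.ofReal h := ENNReal.mul_div_mul_left _ _ hn' (ENNReal.natCast_ne_top n)
    _ = _ := by rw [ENNReal.ofReal_div_of_pos hh, ENNReal.ofReal_one]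

lemma empNorm_ne_top {n : ℕ} (hn : n ≠ 0) (𝒞 : Set (Set E)) (x : Fin n → E) {h : ℝ}
    (hh : 0 < h) : empNorm μ 𝒞 x h ≠ ∞ :=
  ne_top_of_le_ne_top ENNReal.ofReal_ne_top (empNorm_le hn 𝒞 x hh)

lemma toReal_empNorm_le {n : ℕ} (hn : n ≠ 0) (𝒞 : Set (Set E)) (x : Fin n → E) {h : ℝ}
    (hh : 0 < h) : (empNorm μ 𝒞 x h).toReal ≤ 1 / h :=
  ENNReal.toReal_le_of_le_ofReal (by positivity) (empNorm_le hn 𝒞 x hh)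

lemma count_mul_le_empNorm {n : ℕ} (hn : n ≠ 0) {𝒞 : Set (Set E)} {C : Set E} (hC : C ∈ 𝒞)
    (x : Fin n → E) {h : ℝ} (hh : 0 < h) :
    count C x / n * (μ C + ENNReal.ofReal h)⁻¹.toReal ≤ (empNorm μ 𝒞 x h).toReal := by
  have h1 : ENNReal.ofReal (count C x) / ((n : ℝ≥0∞) * (μ C + ENNReal.ofReal h)) ≤
      empNorm μ 𝒞 x h := by
    rw [ofReal_count]
    exact le_iSup₂ (f := fun (C : Set E) (_ : C ∈ 𝒞) =>
      (∑ i : Fin n, C.indicator (fun _ => (1 : ℝ≥0∞)) (x i)) /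
        ((n : ℝ≥0∞) * (μ C + ENNReal.ofReal h))) C hC
  have h2 := ENNReal.toReal_mono (empNorm_ne_top hn 𝒞 x hh) h1
  rw [ENNReal.toReal_div, ENNReal.toReal_mul, ENNReal.toReal_natCast,
    ENNReal.toReal_ofReal (count_nonneg C x)] at h2
  rw [ENNReal.toReal_inv]
  refine le_trans (le_of_eq ?_) h2
  rw [← div_div]; rfl

lemma toReal_inv_add_le (C : Set E) {h : ℝ} (hh : 0 < h) :
    (μ C + ENNReal.ofReal h)⁻¹.toReal ≤ 1 / h := by
  refine ENNReal.toReal_le_of_le_ofReal (by positivity) ?_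
  rw [one_div, ENNReal.ofReal_inv_of_pos hh, ENNReal.inv_le_inv]
  exact le_add_self

lemma logMinus_nonneg (h : ℝ) : 0 ≤ logMinus h := le_max_left _ _

lemma pen_nonneg {n : ℕ} (𝒞 : Set (Set E)) (V : ℕ) {a : ℝ} (ha : 0 < a) (x : Fin n → E) {h : ℝ}
    (hh : 0 < h) : 0 ≤ pen μ 𝒞 V a x h := by
  have := half_le_Gam n V
  have := logMinus_nonneg h
  have : 0 ≤ Gam n V + a * logMinus h := by positivity
  unfold pen
  positivity

lemma pen_le_pen {n : ℕ} (hn : n ≠ 0) (𝒞 : Set (Set E)) (V : ℕ) {a : ℝ} (ha : 0 < a)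
    (x : Fin n → E) {h h' : ℝ} (hh : 0 < h) (hle : h ≤ h') :
    pen μ 𝒞 V a x h' ≤ pen μ 𝒞 V a x h := by
  have hn' : (0 : ℝ) < n := by exact_mod_cast Nat.pos_of_ne_zero hn
  have h0 := half_le_Gam n V
  have h1 := logMinus_nonneg h'
  have h2 : logMinus h' ≤ logMinus h := by
    unfold logMinus
    exact max_le_max le_rfl (neg_le_neg (Real.log_le_log hh hle))
  have h3 : 0 ≤ Gam n V + a * logMinus h' := by positivity
  have h4 : Gam n V + a * logMinus h' ≤ Gam n V + a * logMinus h := by gcongr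
  have h5 : (empNorm μ 𝒞 x h').toReal ≤ (empNorm μ 𝒞 x h).toReal := by
    refine ENNReal.toReal_mono (empNorm_ne_top hn 𝒞 x hh) (iSup₂_mono fun C _ => ?_)
    gcongr
  have h6 : 0 ≤ (empNorm μ 𝒞 x h').toReal := ENNReal.toReal_nonneg
  unfold pen
  gcongr
  · exact mul_nonneg (h6.trans h5) (h3.trans h4)
  · exact h3.trans h4

lemma penTop_nonneg {n : ℕ} (𝒞 : Set (Set E)) (V : ℕ) {a : ℝ} (ha : 0 < a) (x : Fin n → E)
    {h : ℝ≥0∞} (hh : h ≠ 0) : 0 ≤ penTop μ 𝒞 V a x h := by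
  unfold penTop
  split_ifs with htop
  · exact le_rfl
  · exact pen_nonneg 𝒞 V ha x (ENNReal.toReal_pos hh htop)

lemma penTop_le_pen {n : ℕ} (hn : n ≠ 0) (𝒞 : Set (Set E)) (V : ℕ) {a : ℝ} (ha : 0 < a)
    (x : Fin n → E) {h : ℝ} (hh : 0 < h) {h' : ℝ≥0∞} (hle : ENNReal.ofReal h ≤ h') :
    penTop μ 𝒞 V a x h' ≤ pen μ 𝒞 V a x h := by
  unfold penTop
  split_ifs with htop
  · exact pen_nonneg 𝒞 V ha x hh
  · exact pen_le_pen hn 𝒞 V ha x hh ((ENNReal.ofReal_le_iff_le_toReal htop).1 hle)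

/-! ### From relative deviations to the penalty -/

/-- The remainder term of the oracle inequality, without the tolerance. -/
noncomputable def remainder (n : ℕ) (a y : ℝ) : ℝ :=
  29 * y * √(2 * a / (3 * Real.exp 1 * n)) + 29 ^ 2 * (4 / √3) * (a * y / (Real.exp 1 * n))

lemma remainder_nonneg (n : ℕ) {a y : ℝ} (ha : 0 < a) (hy : 0 ≤ y) : 0 ≤ remainder n a y := by
  unfold remainder; positivity

lemma log_le_div_exp_one {u : ℝ} (hu : 0 < u) : Real.log u ≤ u / Real.exp 1 := by
  have h1 := Real.log_le_sub_one_of_pos (div_pos hu (Real.exp_pos 1))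
  rw [Real.log_div hu.ne' (Real.exp_pos 1).ne', Real.log_exp] at h1
  linarith

/-- The left side is log u with u = y min(h, 1) ≤ yh. The linear bound cancels the 1/h of the
additive penalty term, the quadratic one the 1/h² under the square root. -/
lemma log_sub_logMinus_le {y h : ℝ} (hy : 0 < y) (hh : 0 < h) :
    Real.log y - logMinus h ≤ y * h / Real.exp 1 ∧
      Real.log y - logMinus h ≤ (y * h) ^ 2 / (2 * Real.exp 1) := by
  have key : ∃ u, 0 < u ∧ u ≤ y * h ∧ Real.log y - logMinus h ≤ Real.log u := by
    rcases le_total h 1 with h1 | h1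
    · refine ⟨y * h, by positivity, le_rfl, ?_⟩
      have : -Real.log h ≤ logMinus h := le_max_right _ _
      rw [Real.log_mul hy.ne' hh.ne']
      linarith
    · refine ⟨y, hy, le_mul_of_one_le_right hy.le h1, ?_⟩
      have := logMinus_nonneg h
      linarith
  obtain ⟨u, hu, huy, hlog⟩ := key
  constructor
  · refine hlog.trans ((log_le_div_exp_one hu).trans ?_)
    gcongr
  · have h1 := log_le_div_exp_one (pow_pos hu 2)
    rw [Real.log_pow] at h1
    have h2 : u ^ 2 / Real.exp 1 ≤ (y * h) ^ 2 / Real.exp 1 := by gcongr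
    have h3 : (y * h) ^ 2 / (2 * Real.exp 1) = (y * h) ^ 2 / Real.exp 1 / 2 := by
      rw [mul_comm 2, div_div]
    push_cast at h1
    rw [h3]; linarith

/-- Passing from the expected to the observed count in a relative deviation bound. -/
lemma abs_sub_le_of_relDev {k m L : ℝ} (hk : 0 ≤ k) (hm : 0 ≤ m) (hL : 0 ≤ L)
    (h : |k - m| ≤ max (16 * √(m * L)) (16 * L)) : |k - m| ≤ 16 * √(k * L) + 256 * L := by
  set D := |k - m| with hD
  have hD0 : 0 ≤ D := abs_nonneg _
  have hz := Real.sqrt_nonneg (k * L)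
  have hz2 := Real.sq_sqrt (mul_nonneg hk hL)
  rcases le_max_iff.1 h with h1 | h1
  · by_contra! hlt
    have h2 := Real.sqrt_nonneg (m * L)
    have h3 := Real.sq_sqrt (mul_nonneg hm hL)
    have h4 : D ^ 2 ≤ 256 * (m * L) := by nlinarith
    have h5 : m ≤ k + D := by
      have := neg_abs_le (k - m)
      linarith
    have h6 : m * L ≤ (k + D) * L := by gcongr
    -- Here D² ≤ 256kL + 256LD, impossible for D > 16√(kL) + 256L.
    nlinarith
  · linarith

lemma sqrt_add_le_sqrt_add_sqrt {u v : ℝ} (hu : 0 ≤ u) (hv : 0 ≤ v) : √(u + v) ≤ √u + √v := by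
  refine Real.sqrt_le_iff.2 ⟨by positivity, ?_⟩
  have := mul_nonneg (Real.sqrt_nonneg u) (Real.sqrt_nonneg v)
  rw [add_sq, Real.sq_sqrt hu, Real.sq_sqrt hv]
  linarith

/-- Split L/(hn) into the penalty's part s and the excess b of a log y over a log_-(h).
Subadditivity of the square root sends s to the penalty and b to the remainder. -/
lemma weighted_deviation_le {n : ℕ} (hn : n ≠ 0) {𝒞 : Set (Set E)} {V : ℕ} {a y : ℝ}
    (ha : 0 < a) (hy : Real.exp 1 ≤ y) {C : Set E} (hC : C ∈ 𝒞) {x : Fin n → E} {m : ℝ}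
    (hm : 0 ≤ m) (hdev : |count C x - m| ≤ max (16 * √(m * (Gam n V + a * Real.log y)))
      (16 * (Gam n V + a * Real.log y))) {h : ℝ} (hh : 0 < h) :
    |(n : ℝ)⁻¹ * m - (n : ℝ)⁻¹ * count C x| * (μ C + ENNReal.ofReal h)⁻¹.toReal ≤
      pen μ 𝒞 V a x h + remainder n a y / 2 := by
  have hn' : (0 : ℝ) < n := by exact_mod_cast Nat.pos_of_ne_zero hn
  have he := Real.exp_pos 1
  have hy0 : 0 < y := he.trans_le hy
  have hlogy : 0 ≤ Real.log y := Real.log_nonneg ((Real.one_le_exp zero_le_one).trans hy)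
  have hG := half_le_Gam n V
  have hℓ := logMinus_nonneg h
  have hk := count_nonneg C x
  have hw1 := toReal_inv_add_le (μ := μ) C hh
  have hN1 := toReal_empNorm_le (μ := μ) hn 𝒞 x hh
  have hkN := count_mul_le_empNorm (μ := μ) hn hC x hh
  obtain ⟨hb1, hb2⟩ := log_sub_logMinus_le hy0 hh
  unfold pen remainder
  set k := count C x
  set w := (μ C + ENNReal.ofReal h)⁻¹.toReal with hw
  have hw0 : 0 ≤ w := ENNReal.toReal_nonneg
  set N := (empNorm μ 𝒞 x h).toReal with hN
  have hN0 : 0 ≤ N := ENNReal.toReal_nonneg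
  set G := Gam n V
  set ℓ := logMinus h
  set L := G + a * Real.log y with hL
  have hL0 : 0 ≤ L := by positivity
  set s := (G + a * ℓ) / (h * n) with hs
  have hs0 : 0 ≤ s := by positivity
  set b := max 0 (a * (Real.log y - ℓ) / (h * n)) with hb
  have hb0 : 0 ≤ b := le_max_left _ _
  have hLb : L / (h * n) ≤ s + b := by
    have : L / (h * n) = s + a * (Real.log y - ℓ) / (h * n) := by
      rw [hs, hL]; field_simp; ring
    rw [this]
    gcongr
    exact le_max_right _ _
  have hbE : b ≤ a * y / (Real.exp 1 * n) := by
    refine max_le (by positivity) ?_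
    calc a * (Real.log y - ℓ) / (h * n) ≤ a * (y * h / Real.exp 1) / (h * n) := by gcongr
      _ = _ := by field_simp
  have hbS : N * b ≤ y ^ 2 * (a / (2 * Real.exp 1 * n)) := by
    have h1 : b / h ≤ y ^ 2 * (a / (2 * Real.exp 1 * n)) := by
      rw [div_le_iff₀ hh]
      refine max_le (by positivity) ?_
      calc a * (Real.log y - ℓ) / (h * n) ≤ a * ((y * h) ^ 2 / (2 * Real.exp 1)) / (h * n) := by
            gcongr
        _ = _ := by field_simp
    calc N * b ≤ 1 / h * b := by gcongr
      _ = b / h := by ring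
      _ ≤ _ := h1
  have h1 := abs_sub_le_of_relDev hk hm hL0 hdev
  have h2 : |(n : ℝ)⁻¹ * m - (n : ℝ)⁻¹ * k| * w = |k - m| * (w / n) := by
    rw [← mul_sub, abs_mul, abs_of_nonneg (by positivity : (0 : ℝ) ≤ (n : ℝ)⁻¹), abs_sub_comm]
    ring
  have h3 : L * (w / n) ≤ s + b := by
    refine le_trans ?_ hLb
    calc L * (w / n) ≤ L * (1 / h / n) := by gcongr
      _ = _ := by field_simp
  have h4 : √(k * L) * (w / n) ≤ √(N * s) + √(N * b) := by
    have : √(k * L) * (w / n) = √((k / n * w) * (L * (w / n))) := by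
      rw [show k / n * w * (L * (w / n)) = k * L * (w / n) ^ 2 by ring,
        Real.sqrt_mul (show 0 ≤ k * L by positivity), Real.sqrt_sq (by positivity)]
    rw [this]
    calc √((k / n * w) * (L * (w / n))) ≤ √(N * (s + b)) := by gcongr
      _ = √(N * s + N * b) := by rw [mul_add]
      _ ≤ _ := sqrt_add_le_sqrt_add_sqrt (by positivity) (by positivity)
  have h5 : 16 * √(N * b) ≤ 29 * y * √(2 * a / (3 * Real.exp 1 * n)) / 2 := by
    have e1 : √(N * b) ≤ y * √(a / (2 * Real.exp 1 * n)) := by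
      refine (Real.sqrt_le_sqrt hbS).trans (le_of_eq ?_)
      rw [Real.sqrt_mul (by positivity), Real.sqrt_sq hy0.le]
    -- After squaring: 256/2 = 128 ≤ (29/2)² · 2/3.
    have e2 : 16 * √(a / (2 * Real.exp 1 * n)) ≤ 29 / 2 * √(2 * a / (3 * Real.exp 1 * n)) := by
      refine abs_le_of_sq_le_sq' ?_ (by positivity) |>.2
      rw [mul_pow, mul_pow, Real.sq_sqrt (by positivity), Real.sq_sqrt (by positivity)]
      have e3 : a / (2 * Real.exp 1 * n) = (a / (Real.exp 1 * n)) * (1 / 2) := by field_simp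
      have e4 : 2 * a / (3 * Real.exp 1 * n) = (a / (Real.exp 1 * n)) * (2 / 3) := by field_simp
      have e5 : 0 ≤ a / (Real.exp 1 * n) := by positivity
      rw [e3, e4]
      linarith
    nlinarith
  have h6 : 1 ≤ √(4 / 3 : ℝ) := Real.one_le_sqrt.2 (by norm_num)
  have h7 : 2 ≤ 4 / √(3 : ℝ) := by
    rw [le_div_iff₀ (by positivity)]
    have : √(3 : ℝ) ≤ 2 := Real.sqrt_le_iff.2 (by norm_num)
    linarith
  have h8 : √(N * s) = √(N * (G + a * ℓ) / (h * n)) := by rw [hs, mul_div_assoc]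
  rw [← h8, h2]
  have h9 : |k - m| * (w / n) ≤ 16 * (√(N * s) + √(N * b)) + 256 * (s + b) := by
    calc |k - m| * (w / n) ≤ (16 * √(k * L) + 256 * L) * (w / n) := by gcongr
      _ = 16 * (√(k * L) * (w / n)) + 256 * (L * (w / n)) := by ring
      _ ≤ _ := by gcongr
  have h10 : 16 * √(N * s) ≤ 29 * √(4 / 3) * √(N * s) := by
    gcongr; linarith
  have h11 : 256 * s ≤ √(4 / 3) * 29 ^ 2 * s := by
    gcongr; linarith
  have h12 : 256 * b ≤ 29 ^ 2 * (4 / √3) * (a * y / (Real.exp 1 * n)) / 2 := by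
    have : 256 * 2 * b ≤ 29 ^ 2 * (4 / √3) * (a * y / (Real.exp 1 * n)) := by
      gcongr; norm_num
    linarith
  linarith

end Penalty

section Oracle

variable {E : Type*} [MeasurableSpace E] {μ : Measure E}

/-! ### The oracle inequality on the deviation event -/

/-- The test sets compared by the selection procedure at finite bandwidths. -/
def relevantSets (ℳ : Set (Set (LinfL1 μ))) (hM : Set (LinfL1 μ) → ℝ)
    (Csq : ℝ → LinfL1 μ → LinfL1 μ → Set E) : Set (Set E) :=
  (fun z : LinfL1 μ × LinfL1 μ => Csq (min (hOf ℳ hM z.1) (hOf ℳ hM z.2)).toReal z.1 z.2) ''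
    {z | (z.1 ∈ ⋃₀ ℳ ∧ z.2 ∈ ⋃₀ ℳ) ∧ min (hOf ℳ hM z.1) (hOf ℳ hM z.2) ≠ ∞}

lemma hOf_ne_zero {𝒞 : Set (Set E)} {ℳ : Set (Set (LinfL1 μ))} {hM : Set (LinfL1 μ) → ℝ}
    {Csq : ℝ → LinfL1 μ → LinfL1 μ → Set E} (H : ModelSelectionAssumptions 𝒞 ℳ hM Csq)
    {p : LinfL1 μ} (hp : p ∈ ⋃₀ ℳ) : hOf ℳ hM p ≠ 0 := by
  obtain ⟨m, hm, hpm⟩ := hp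
  have h1 := ofReal_le_hOf hM hm hpm
  have h2 : 0 < ENNReal.ofReal (hM m) := ENNReal.ofReal_pos.2 (H.bandwidth_pos m hm)
  exact (h2.trans_le h1).ne'

lemma min_hOf_ne_zero {𝒞 : Set (Set E)} {ℳ : Set (Set (LinfL1 μ))} {hM : Set (LinfL1 μ) → ℝ}
    {Csq : ℝ → LinfL1 μ → LinfL1 μ → Set E} (H : ModelSelectionAssumptions 𝒞 ℳ hM Csq)
    {p q : LinfL1 μ} (hp : p ∈ ⋃₀ ℳ) (hq : q ∈ ⋃₀ ℳ) :
    min (hOf ℳ hM p) (hOf ℳ hM q) ≠ 0 :=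
  (lt_min (pos_iff_ne_zero.2 (hOf_ne_zero H hp)) (pos_iff_ne_zero.2 (hOf_ne_zero H hq))).ne'

lemma relevantSets_subset {𝒞 : Set (Set E)} {ℳ : Set (Set (LinfL1 μ))}
    {hM : Set (LinfL1 μ) → ℝ} {Csq : ℝ → LinfL1 μ → LinfL1 μ → Set E}
    (H : ModelSelectionAssumptions 𝒞 ℳ hM Csq) : relevantSets ℳ hM Csq ⊆ 𝒞 := by
  rintro _ ⟨⟨p, q⟩, ⟨⟨hp, hq⟩, hfin⟩, rfl⟩
  exact H.testSet_mem _ (ENNReal.toReal_pos (min_hOf_ne_zero H hp hq) hfin) p q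

lemma countable_relevantSets {𝒞 : Set (Set E)} {ℳ : Set (Set (LinfL1 μ))}
    {hM : Set (LinfL1 μ) → ℝ} {Csq : ℝ → LinfL1 μ → LinfL1 μ → Set E}
    (H : ModelSelectionAssumptions 𝒞 ℳ hM Csq) : (relevantSets ℳ hM Csq).Countable := by
  have hM' : (⋃₀ ℳ).Countable := H.countable_collection.sUnion H.countable_models
  exact ((hM'.prod hM').mono fun z hz => hz.1).image _

lemma penTop_min_le {n : ℕ} (𝒞 : Set (Set E)) (V : ℕ) {a : ℝ} (ha : 0 < a) (x : Fin n → E)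
    {h h' : ℝ≥0∞} (hh : h ≠ 0) (hh' : h' ≠ 0) :
    penTop μ 𝒞 V a x (min h h') ≤ penTop μ 𝒞 V a x h + penTop μ 𝒞 V a x h' := by
  have h1 := penTop_nonneg (μ := μ) 𝒞 V ha x hh
  have h2 := penTop_nonneg (μ := μ) 𝒞 V ha x hh'
  rcases min_choice h h' with h3 | h3 <;> rw [h3] <;> linarith

/-- `hupper` bounds the criterion at p, `hlower` bounds the distance between estimator and p by
their test. Near-minimality links them, and the triangle inequality passes to p*. -/
lemma oracleInequality_of_deviation {n : ℕ} (hn : n ≠ 0) {𝒞 : Set (Set E)} {V : ℕ} {a y : ℝ}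
    (ha : 0 < a) (hy : Real.exp 1 ≤ y) {pstar : LinfL1 μ} {ℳ : Set (Set (LinfL1 μ))}
    {hM : Set (LinfL1 μ) → ℝ} {Csq : ℝ → LinfL1 μ → LinfL1 μ → Set E}
    (H : ModelSelectionAssumptions 𝒞 ℳ hM Csq) {x : Fin n → E} {M : Set E → ℝ}
    (hM0 : ∀ C, 0 ≤ M C) (hMC : ∀ C ∈ 𝒞, mass pstar C = (n : ℝ)⁻¹ * M C)
    (hdev : ∀ C ∈ relevantSets ℳ hM Csq,
      |count C x - M C| ≤ max (16 * √(M C * (Gam n V + a * Real.log y)))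
        (16 * (Gam n V + a * Real.log y))) :
    OracleInequality 𝒞 V a y pstar ℳ hM Csq x := by
  intro ε hε1 hε δ hδ phat hphat
  obtain ⟨hphatM, hsel⟩ := hphat
  have hR := remainder_nonneg n ha ((Real.exp_pos 1).le.trans hy)
  set R := remainder n a y with hRdef
  set P : LinfL1 μ → ℝ := fun p => penTop μ 𝒞 V a x (hOf ℳ hM p) with hP
  set T : LinfL1 μ → LinfL1 μ → ℝ := fun p q =>
    testStat Csq x (min (hOf ℳ hM p) (hOf ℳ hM q)) p q with hT
  have hP0 : ∀ p ∈ ⋃₀ ℳ, 0 ≤ P p := fun p hp => penTop_nonneg 𝒞 V ha x (hOf_ne_zero H hp)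
  have hw : ∀ p ∈ ⋃₀ ℳ, ∀ q ∈ ⋃₀ ℳ, ∀ h, min (hOf ℳ hM p) (hOf ℳ hM q) = h → h ≠ ∞ →
      |mass pstar (Csq h.toReal p q) - (n : ℝ)⁻¹ * count (Csq h.toReal p q) x| *
        (μ (Csq h.toReal p q) + h)⁻¹.toReal ≤ P p + P q + R / 2 := by
    rintro p hp q hq h rfl hfin
    have hmem : Csq (min (hOf ℳ hM p) (hOf ℳ hM q)).toReal p q ∈ relevantSets ℳ hM Csq :=
      ⟨(p, q), ⟨⟨hp, hq⟩, hfin⟩, rfl⟩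
    have h0 := min_hOf_ne_zero H hp hq
    have hpen := penTop_min_le (μ := μ) 𝒞 V ha x (hOf_ne_zero H hp) (hOf_ne_zero H hq)
    set h := min (hOf ℳ hM p) (hOf ℳ hM q) with hh
    have h1 := weighted_deviation_le (μ := μ) hn ha hy (relevantSets_subset H hmem) (hM0 _)
      (hdev _ hmem) (ENNReal.toReal_pos h0 hfin)
    rw [ENNReal.ofReal_toReal hfin, ← hMC _ (relevantSets_subset H hmem)] at h1
    rw [penTop, if_neg hfin] at hpen
    linarith
  have hupper : ∀ p ∈ ⋃₀ ℳ, ∀ q ∈ ⋃₀ ℳ,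
      T p q ≤ (supNorm (p - pstar)).toReal + P p + P q + R / 2 := by
    intro p hp q hq
    have hs : 0 ≤ (supNorm (p - pstar)).toReal := ENNReal.toReal_nonneg
    by_cases hfin : min (hOf ℳ hM p) (hOf ℳ hM q) = ∞
    · have := hP0 p hp
      have := hP0 q hq
      simp only [hT, hfin, testStat_top]
      positivity
    · have h1 := testStat_le hn Csq x (min (hOf ℳ hM p) (hOf ℳ hM q)) p q pstar
      have h2 := hw p hp q hq _ rfl hfin
      simp only [hT]
      linarith
  have hlower : ∀ p ∈ ⋃₀ ℳ, ∀ q ∈ ⋃₀ ℳ,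
      (1 - (ε : ℝ≥0∞)) * kappaStar 𝒞 ℳ hM * supNorm (p - q) ≤ ENNReal.ofReal
        (T p q + (supNorm (q - pstar)).toReal + P p + P q + R / 2) := by
    intro p hp q hq
    rw [mul_assoc]
    by_cases hfin : min (hOf ℳ hM p) (hOf ℳ hM q) = ∞
    · rw [kappaStar_mul_supNorm_eq_zero hfin, mul_zero]
      exact zero_le
    have hpos := ENNReal.toReal_pos (min_hOf_ne_zero H hp hq) hfin
    have h1 := kappaStar_mul_supNorm_le (𝒞 := 𝒞) hpos (ENNReal.ofReal_toReal hfin).symm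
    have h2 := abs_mass_mul_le_testStat hn Csq x (min (hOf ℳ hM p) (hOf ℳ hM q)) p q pstar
    have h3 := hw p hp q hq _ rfl hfin
    have h4 := one_sub_mul_hNorm_le ((le_iSup₂ (f := fun (h : ℝ) (_ : 0 < h) =>
      testError 𝒞 (⋃₀ ℳ) h (Csq h)) _ hpos).trans hε) hp hq
    rw [ENNReal.ofReal_toReal hfin] at h4
    refine (mul_le_mul_right h1 _).trans (h4.trans ?_)
    have hne : (μ (Csq (min (hOf ℳ hM p) (hOf ℳ hM q)).toReal p q) +
        min (hOf ℳ hM p) (hOf ℳ hM q))⁻¹ ≠ ∞ :=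
      ENNReal.inv_ne_top.2 (by simp [hOf_ne_zero H hp, hOf_ne_zero H hq])
    rw [div_eq_mul_inv, ← ENNReal.ofReal_toReal hne, ← ENNReal.ofReal_mul (abs_nonneg _)]
    refine ENNReal.ofReal_le_ofReal ?_
    simp only [hT]
    linarith
  -- The convention 0/0 = 1 on the diagonal gives κ_* ≤ 1.
  have hκ : kappaStar 𝒞 ℳ hM ≠ ∞ := by
    obtain ⟨m, hm, hpm⟩ := hphatM
    refine ne_top_of_le_ne_top ENNReal.one_ne_top (((iInf₂_le m hm).trans (iInf₂_le m hm)).trans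
      (((iInf₂_le phat (Or.inl hpm)).trans (iInf₂_le phat (Or.inl hpm))).trans ?_))
    rw [if_pos rfl]
  set K := (1 - (ε : ℝ≥0∞)) * kappaStar 𝒞 ℳ hM with hK
  have hKfin : K ≠ ∞ := ENNReal.mul_ne_top (by finiteness) hκ
  have hmain : ∀ m ∈ ℳ, ∀ p ∈ m, K * supNorm (phat - pstar) ≤
      (2 + K) * supNorm (p - pstar) + (4 * ENNReal.ofReal (pen μ 𝒞 V a x (hM m)) +
        ENNReal.ofReal (R + δ)) := by
    intro m hm p hpm
    have hp : p ∈ ⋃₀ ℳ := ⟨m, hm, hpm⟩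
    have hhm := H.bandwidth_pos m hm
    have hpen : P p ≤ pen μ 𝒞 V a x (hM m) :=
      penTop_le_pen hn 𝒞 V ha x hhm (ofReal_le_hOf hM hm hpm)
    set s := (supNorm (p - pstar)).toReal with hs
    have hs0 : 0 ≤ s := ENNReal.toReal_nonneg
    have hsel1 : selStat 𝒞 V a ℳ hM Csq x p ≤ ((s + 2 * P p + R / 2 : ℝ) : EReal) := by
      have : (⨆ q ∈ ⋃₀ ℳ, ((T p q - P q : ℝ) : EReal)) ≤ ((s + P p + R / 2 : ℝ) : EReal) := by
        refine iSup₂_le fun q hq => EReal.coe_le_coe_iff.2 ?_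
        have := hupper p hp q hq
        linarith
      refine (add_le_add_left this ((P p : ℝ) : EReal)).trans (le_of_eq ?_)
      rw [← EReal.coe_add]
      congr 1; ring
    have hsel2 : ((T phat p - P p + P phat : ℝ) : EReal) ≤ selStat 𝒞 V a ℳ hM Csq x phat := by
      rw [EReal.coe_add]
      exact add_le_add_left (le_iSup₂ (f := fun q (_ : q ∈ ⋃₀ ℳ) =>
        ((T phat q - P q : ℝ) : EReal)) p hp) _
    have hsel3 : T phat p - P p + P phat ≤ s + 2 * P p + R / 2 + δ := by
      rw [← EReal.coe_le_coe_iff, EReal.coe_add (s + 2 * P p + R / 2)]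
      refine hsel2.trans (hsel.trans (add_le_add_left ?_ _))
      exact (iInf₂_le p hp).trans hsel1
    have h1 : K * supNorm (phat - p) ≤ 2 * supNorm (p - pstar) +
        (4 * ENNReal.ofReal (pen μ 𝒞 V a x (hM m)) + ENNReal.ofReal (R + δ)) := by
      -- Adding `hsel3` cancels the penalty of `phat` and leaves 2s + 4 P p + R + δ.
      have h0 := hlower phat hphatM p hp
      rw [← hs] at h0
      refine h0.trans ?_
      have hpen0 := pen_nonneg (μ := μ) 𝒞 V ha x hhm
      rw [show supNorm (p - pstar) = ENNReal.ofReal s from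
          (ENNReal.ofReal_toReal (supNorm_ne_top _)).symm,
        show (2 : ℝ≥0∞) = ENNReal.ofReal 2 by simp, show (4 : ℝ≥0∞) = ENNReal.ofReal 4 by simp,
        ← ENNReal.ofReal_mul (by norm_num), ← ENNReal.ofReal_mul (by norm_num),
        ← ENNReal.ofReal_add (by positivity) (by positivity),
        ← ENNReal.ofReal_add (by positivity) (by positivity)]
      refine ENNReal.ofReal_le_ofReal ?_
      linarith
    have h2 : supNorm (phat - pstar) ≤ supNorm (phat - p) + supNorm (p - pstar) := by
      have : phat - pstar = (phat - p) + (p - pstar) := by abel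
      rw [this]
      unfold supNorm
      rw [Submodule.coe_add, eLpNorm_congr_ae (AEEqFun.coeFn_add _ _)]
      exact eLpNorm_add_le (AEEqFun.aestronglyMeasurable _) (AEEqFun.aestronglyMeasurable _)
        le_top
    calc K * supNorm (phat - pstar) ≤ K * (supNorm (phat - p) + supNorm (p - pstar)) := by gcongr
      _ = K * supNorm (phat - p) + K * supNorm (p - pstar) := mul_add _ _ _
      _ ≤ _ := add_le_add_left h1 _
      _ = _ := by ring
  change K * supNorm (phat - pstar) ≤ (⨅ m ∈ ℳ, ((2 + K) * (⨅ p ∈ m, supNorm (p - pstar)) +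
    4 * ENNReal.ofReal (pen μ 𝒞 V a x (hM m)))) + ENNReal.ofReal (R + δ)
  -- Move all other terms to the left and divide by 2 + K, nonzero and finite, so that each infimum
  -- stands alone on the right.
  rw [← tsub_le_iff_right]
  refine le_iInf₂ fun m hm => ?_
  rw [tsub_le_iff_right, add_assoc, ← tsub_le_iff_right, mul_comm (2 + K)]
  have h2K : 2 + K ≠ 0 := by simp
  have h2K' : 2 + K ≠ ∞ := by finiteness
  rw [← ENNReal.div_le_iff h2K h2K']
  refine le_iInf₂ fun p hp => ?_
  rw [ENNReal.div_le_iff h2K h2K', tsub_le_iff_right, mul_comm _ (2 + K)]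
  exact hmain m hm p hp

/-! ### Laws with densities and pointwise measurable classes -/

lemma measureReal_eq_mass {P : Measure E} {f : LinfL1 μ} (hpos : 0 ≤ (f : E →ₘ[μ] ℝ))
    (hlaw : P = μ.withDensity fun x => ENNReal.ofReal ((f : E →ₘ[μ] ℝ) x))
    {C : Set E} (hC : MeasurableSet C) : P.real C = mass f C := by
  have h0 : 0 ≤ᵐ[μ] (f : E →ₘ[μ] ℝ) := by
    filter_upwards [AEEqFun.coeFn_le.2 hpos, AEEqFun.coeFn_zero (α := E) (μ := μ) (β := ℝ)]
      with x h1 h2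
    rwa [h2] at h1
  unfold mass
  rw [integral_eq_lintegral_of_nonneg_ae (ae_restrict_of_ae h0)
    (AEEqFun.aestronglyMeasurable _).restrict, Measure.real, hlaw, withDensity_apply _ hC]

/-- Counts and, by bounded convergence, probabilities converge along indicators, and the deviation
bound is a closed condition. -/
lemma relDevEvent_subset_of_pointwise_limit {n : ℕ} {𝒞 𝒞₀ : Set (Set E)}
    (h𝒞 : ∀ C ∈ 𝒞, MeasurableSet C) (hsub : 𝒞₀ ⊆ 𝒞)
    (hlim : ∀ C ∈ 𝒞, ∃ D : ℕ → Set E, (∀ k, D k ∈ 𝒞₀) ∧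
      ∀ x, ∀ᶠ k in Filter.atTop, (x ∈ D k ↔ x ∈ C))
    (P : Fin n → Measure E) [∀ i, IsProbabilityMeasure (P i)] (L : ℝ) :
    relDevEvent 𝒞₀ P L ⊆ relDevEvent (n := n) 𝒞 P L := by
  intro x hx C hC
  obtain ⟨D, hD, hDC⟩ := hlim C hC
  have h1 : Filter.Tendsto (fun k => count (D k) x) Filter.atTop (nhds (count C x)) := by
    refine tendsto_finsetSum _ fun i _ => ?_
    refine tendsto_const_nhds.congr' ?_
    filter_upwards [hDC (x i)] with k hk
    by_cases h : x i ∈ C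
    · simp [h, hk.2 h]
    · simp [h, mt hk.1 h]
  have h2 : Filter.Tendsto (fun k => ∑ i, (P i).real (D k)) Filter.atTop
      (nhds (∑ i, (P i).real C)) := by
    refine tendsto_finsetSum _ fun i _ => ?_
    refine (ENNReal.tendsto_toReal (measure_ne_top _ _)).comp ?_
    exact tendsto_measure_of_tendsto_indicator_of_isFiniteMeasure Filter.atTop (P i)
      (fun k => h𝒞 _ (hsub (hD k))) hDC
  refine le_of_tendsto_of_tendsto' ((h1.sub h2).abs)
    (Filter.Tendsto.max (((h2.mul_const L).sqrt).const_mul 16) tendsto_const_nhds)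
    fun k => hx (D k) (hD k)

lemma preimage_relDevEvent_subset_deviationEvent {Ω : Type*} {n : ℕ} (hn : n ≠ 0)
    (𝒞 : Set (Set E)) (V : ℕ) (P : Fin n → Measure E) (X : Fin n → Ω → E) {x : ℝ} (hx : 0 ≤ x) :
    (fun ω i => X i ω) ⁻¹' relDevEvent 𝒞 P (Gam n V + x) ⊆ deviationEvent 𝒞 V P X x := by
  intro ω hω C hC
  have hn' : (0 : ℝ) < n := by exact_mod_cast Nat.pos_of_ne_zero hn
  have h1 := hω C hC
  have hG := half_le_Gam n V
  have hL : 0 ≤ Gam n V + x := by linarith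
  set L := Gam n V + x
  rw [Finset.sum_sub_distrib]
  change (n : ℝ)⁻¹ * |count C (fun i => X i ω) - ∑ i, (P i).real C| ≤ _
  set m := ∑ i, (P i).real C
  have hm : 0 ≤ m := Finset.sum_nonneg fun i _ => measureReal_nonneg
  have h2 : √((n : ℝ)⁻¹ * m) * √(L / n) = (n : ℝ)⁻¹ * √(m * L) := by
    rw [← Real.sqrt_mul (by positivity), show (n : ℝ)⁻¹ * m * (L / n) = ((n : ℝ)⁻¹) ^ 2 * (m * L) by
      ring, Real.sqrt_mul (by positivity), Real.sqrt_sq (by positivity)]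
  rw [mul_assoc, h2]
  refine (mul_le_mul_of_nonneg_left h1 (by positivity)).trans ?_
  rw [mul_max_of_nonneg _ _ (by positivity)]
  have h3 : 0 ≤ (n : ℝ)⁻¹ * √(m * L) := by positivity
  have h4 : 0 ≤ L / n := by positivity
  refine max_le_max ?_ ?_
  · linarith
  · rw [show (n : ℝ)⁻¹ * (16 * L) = 16 * (L / n) by ring]; linarith

lemma vcDim_mono {α : Type*} {𝒞 𝒟 : Set (Set α)} (h : 𝒟 ⊆ 𝒞) : vcDim 𝒟 ≤ vcDim 𝒞 :=
  iSup_mono fun s => iSup_mono' fun hs => ⟨fun t ht => by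
    obtain ⟨C, hC, hst⟩ := hs t ht
    exact ⟨C, h hC, hst⟩, le_rfl⟩

end Oracle

end SupNormDensity

/-! ### Model selection: from the deviation event to the theorem -/

theorem mainTheorem2 {E : Type*} [MeasurableSpace E] (μ : Measure E) [SigmaFinite μ]
    (𝒞 : Set (Set E)) (h𝒞 : ∀ C ∈ 𝒞, MeasurableSet C)
    (V : ℕ) (hV : SupNormDensity.vcDim 𝒞 = V)
    {Ω : Type*} [MeasurableSpace Ω] (Pr : Measure Ω) [IsProbabilityMeasure Pr]
    (n : ℕ) (hn : 2 ≤ n)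
    (X : Fin n → Ω → E) (hX : ∀ i, Measurable (X i)) (hindep : iIndepFun X Pr)
    (pstar : Fin n → SupNormDensity.LinfL1 μ)
    (hpos : ∀ i, 0 ≤ (pstar i : E →ₘ[μ] ℝ))
    (hlaw : ∀ i, Pr.map (X i) =
      μ.withDensity (fun x => ENNReal.ofReal ((pstar i : E →ₘ[μ] ℝ) x)))
    (a : ℝ) (ha : 0 < a) (y : ℝ) (hy : Real.exp 1 ≤ y) :
    (∀ (ℳ : Set (Set (SupNormDensity.LinfL1 μ))) (hM : Set (SupNormDensity.LinfL1 μ) → ℝ)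
        (Csq : ℝ → SupNormDensity.LinfL1 μ → SupNormDensity.LinfL1 μ → Set E),
        SupNormDensity.ModelSelectionAssumptions 𝒞 ℳ hM Csq →
        ∃ A : Set Ω, MeasurableSet A ∧ 1 - 2 / y ^ a ≤ Pr.real A ∧
          ∀ ω ∈ A, SupNormDensity.OracleInequality 𝒞 V a y ((n : ℝ)⁻¹ • ∑ i, pstar i)
            ℳ hM Csq (fun i => X i ω)) ∧
    (SupNormDensity.PointwiseMeasurableClass 𝒞 →
      ∃ A : Set Ω, MeasurableSet A ∧ 1 - 2 / y ^ a ≤ Pr.real A ∧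
        A ⊆ SupNormDensity.deviationEvent 𝒞 V (fun i => Pr.map (X i)) X (a * Real.log y) ∧
        ∀ (ℳ : Set (Set (SupNormDensity.LinfL1 μ))) (hM : Set (SupNormDensity.LinfL1 μ) → ℝ)
          (Csq : ℝ → SupNormDensity.LinfL1 μ → SupNormDensity.LinfL1 μ → Set E),
          SupNormDensity.ModelSelectionAssumptions 𝒞 ℳ hM Csq →
          ∀ ω ∈ A, SupNormDensity.OracleInequality 𝒞 V a y ((n : ℝ)⁻¹ • ∑ i, pstar i)
            ℳ hM Csq (fun i => X i ω)) := by
  have hn0 : n ≠ 0 := by omega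
  have hlogy : 0 ≤ Real.log y :=
    Real.log_nonneg ((Real.one_le_exp zero_le_one).trans hy)
  have hx : 0 ≤ a * Real.log y := by positivity
  have hy0 : 0 < y := (Real.exp_pos 1).trans_le hy
  have hprob : ∀ r : ℝ, 1 - Real.exp (-(a * Real.log y)) ≤ r → 1 - 2 / y ^ a ≤ r := by
    intro r hr
    have h1 : Real.exp (-(a * Real.log y)) = 1 / y ^ a := by
      rw [Real.exp_neg, Real.rpow_def_of_pos hy0, mul_comm a, one_div]
    have h2 : 0 < y ^ a := Real.rpow_pos_of_pos hy0 a
    have h3 : 1 / y ^ a ≤ 2 / y ^ a := by gcongr; norm_num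
    linarith
  have hP : ∀ i, IsProbabilityMeasure (Pr.map (X i)) := fun i =>
    Measure.isProbabilityMeasure_map (hX i).aemeasurable
  have hmass : ∀ C ∈ 𝒞, SupNormDensity.mass ((n : ℝ)⁻¹ • ∑ i, pstar i) C =
      (n : ℝ)⁻¹ * ∑ i, (Pr.map (X i)).real C := by
    intro C hC
    rw [SupNormDensity.mass_average]
    congr 1
    exact Finset.sum_congr rfl fun i _ =>
      (SupNormDensity.measureReal_eq_mass (hpos i) (hlaw i) (h𝒞 C hC)).symm
  have horacle : ∀ (ℳ : Set (Set (SupNormDensity.LinfL1 μ)))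
      (hM : Set (SupNormDensity.LinfL1 μ) → ℝ)
      (Csq : ℝ → SupNormDensity.LinfL1 μ → SupNormDensity.LinfL1 μ → Set E),
      SupNormDensity.ModelSelectionAssumptions 𝒞 ℳ hM Csq →
      ∀ x ∈ SupNormDensity.relDevEvent (SupNormDensity.relevantSets ℳ hM Csq)
        (fun i => Pr.map (X i)) (SupNormDensity.Gam n V + a * Real.log y),
      SupNormDensity.OracleInequality 𝒞 V a y ((n : ℝ)⁻¹ • ∑ i, pstar i) ℳ hM Csq x :=
    fun ℳ hM Csq H x hx => SupNormDensity.oracleInequality_of_deviation hn0 ha hy H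
      (fun C => Finset.sum_nonneg fun i _ => measureReal_nonneg) hmass hx
  have hmX : Measurable fun ω i => X i ω := measurable_pi_lambda _ hX
  constructor
  -- The event uses only the countably many test sets compared, hence depends on the collection,
  -- bandwidths and test-set map.
  · intro ℳ hM Csq H
    have hsub := SupNormDensity.relevantSets_subset H
    have hc := SupNormDensity.countable_relevantSets H
    have hm := fun C hC => h𝒞 C (hsub hC)
    exact ⟨_, hmX (SupNormDensity.measurableSet_relDevEvent hc hm _ _),
      hprob _ (SupNormDensity.one_sub_exp_le_measureReal_relDevEvent hc hm
        ((SupNormDensity.vcDim_mono hsub).trans hV.le) Pr hX hindep hx),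
      fun ω hω => horacle ℳ hM Csq H _ hω⟩
  -- The event built from 𝒞₀ controls all of 𝒞, hence every choice of models and test sets at once.
  · rintro ⟨𝒞₀, hsub, hc, hlim⟩
    have hm := fun C hC => h𝒞 C (hsub hC)
    have hext := SupNormDensity.relDevEvent_subset_of_pointwise_limit h𝒞 hsub hlim
      (fun i => Pr.map (X i)) (SupNormDensity.Gam n V + a * Real.log y)
    exact ⟨_, hmX (SupNormDensity.measurableSet_relDevEvent hc hm _ _),
      hprob _ (SupNormDensity.one_sub_exp_le_measureReal_relDevEvent hc hm
        ((SupNormDensity.vcDim_mono hsub).trans hV.le) Pr hX hindep hx),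
      (Set.preimage_mono hext).trans
        (SupNormDensity.preimage_relDevEvent_subset_deviationEvent hn0 𝒞 V _ X hx),
      fun ℳ hM Csq H ω hω => horacle ℳ hM Csq H _ fun C hC =>
        hext hω C (SupNormDensity.relevantSets_subset H hC)⟩
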